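/- Let $k$ be a field of characteristic zero and let $A=kQ/I$ be a gentle algebra: $Q$ is a finite quiver, $I$ is generated by a set of paths of length two, at each vertex of $Q$ at most two arrows start and at most two arrows end, and for every arrow $\alpha$ there is at most one arrow $\beta$ with $t(\alpha)=s(\beta)$ and $\alpha\beta\in I$, at most one such $\beta$ with $\alpha\beta\notin I$, at most one arrow $\gamma$ with $t(\gamma)=s(\alpha)$ and $\gamma\alpha\in I$, and at most one such $\gamma$ with $\gamma\alpha\notin I$. (Paths are written from left to right.) Assume that $Q$ has no oriented cycles and no parallel arrows. Notation. $AP_n$ is the set of sequences of composable arrows $(\alpha_1,\dots,\alpha_n)$ with $\alpha_i\alpha_{i+1}=0$ in $A$ for all $i$, $E=kQ_0$, and $B^1(A)[1]=\operatorname{Hom}_{E-E}(k\,AP_2,A)$, with basis the maps $(\alpha\beta\|u)$, where $(\alpha,\beta)\in AP_2$ and $u$ is a nonzero path of $A$ parallel to $\alpha\beta$; $(\alpha\beta\|u)$ sends $(\alpha,\beta)$ to $u$ and every other element of $AP_2$ to $0$. The brackets $l_n$ ($n\ge 2$) of the $L_\infty$-structure on the shifted Bardzell complex of $A$ are given on $f_1,\dots,f_n\in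 B^1(A)[1]$ by $$l_n(f_1,\dots,f_n)(\alpha_1,\alpha_2,\alpha_3)=v_n(f_1,\dots,f_n)(\alpha_1\otimes\alpha_2\otimes\alpha_3),\qquad(\alpha_1,\alpha_2,\alpha_3)\in AP_3,$$ where $\phi_1=G^*$, $v_1=0$, and, for $n\ge2$, $\phi_n=H^*v_n$ and $$v_n(f_1,\dots,f_n)=\sum_{t=1}^{n-1}\sum_{\tau}(-1)^{t-1+(n-t-1)t}\,\bigl[\phi_t(f_{\tau(1)},\dots,f_{\tau(t)}),\phi_{n-t}(f_{\tau(t+1)},\dots,f_{\tau(n)})\bigr],$$ $\tau$ running over the permutations with $\tau(1)<\dots<\tau(t)$, $\tau(t+1)<\dots<\tau(n)$ and $\tau(1)<\tau(t+1)$. Here $[g,h]=g(h\otimes\mathrm{id}-\mathrm{id}\otimes h)+h(g\otimes\mathrm{id}-\mathrm{id}\otimes g)$ is the Gerstenhaber bracket of bilinear maps $g,h:A\otimes A\to A$. For nonzero paths $p=\beta_1\cdots\beta_m$ and $q=\gamma_1\cdots\gamma_r$ of positive length, $$(G^*f)(p\otimes q)=\Theta\,\beta_1\cdots\beta_{m-1}\,f(\beta_m,\gamma_1)\,\gamma_2\cdots\gamma_r,$$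 $$(H^*v)(p\otimes q)=\Theta\, v(\beta_1\cdots\beta_{m-1}\otimes\beta_m\otimes\gamma_1)\,\gamma_2\cdots\gamma_r-\sum_{i=2}^{r}v(p\otimes\gamma_1\cdots\gamma_{i-1}\otimes\gamma_i)\,\gamma_{i+1}\cdots\gamma_r,$$ with $\Theta=1$ if $(\beta_m,\gamma_1)\in AP_2$ and $\Theta=0$ otherwise, and $G^*f$ and $H^*v$ vanish when $p$ or $q$ is a trivial path. A subquiver of the form $(\diamond)$ of $Q$ consists of pairwise distinct vertices $1,\dots,6$, arrows $\alpha_1:1\to2$, $\alpha_2:2\to3$, $\alpha_3:3\to4$, $\beta_1:1\to5$, $\beta_2:5\to2$, $\epsilon_1:2\to6$, $\lambda:5\to6$, and a path $\epsilon_2\cdots\epsilon_p$, $p\ge2$, from $6$ to $4$, such that $\omega=(\alpha_1,\alpha_2,\alpha_3)\in AP_3$, $\beta_1\beta_2\ne0$ and $\epsilon_1\cdots\epsilon_p\neq0$ in $A$ ($\epsilon_p=\alpha_3$ is allowed). Theorem. (1) If $f_1,f_2,f_3,f_4\in B^1(A)[1]$ and $l_4(f_1,f_2,f_3,f_4)\ne0$,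 then $Q$ contains a subquiver of the form $(\diamond)$ such that $l_4(f_1,f_2,f_3,f_4)(\omega)\neq0$ for its $\omega=(\alpha_1,\alpha_2,\alpha_3)$. (2) Conversely, for every subquiver of the form $(\diamond)$ of $Q$, the elements $$f_1=(\alpha_1\alpha_2\|\beta_1\beta_2\alpha_2),\quad f_2=(\alpha_2\alpha_3\|\epsilon_1\cdots\epsilon_p),\quad f_3=(\beta_2\epsilon_1\|\lambda),\quad f_4=(\beta_1\lambda\|\alpha_1\epsilon_1)$$ of $B^1(A)[1]$ are well defined, and $l_4(f_1,f_2,f_3,f_4)(\omega)=-\alpha_1\epsilon_1\cdots\epsilon_p\ne0$. -/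

import Mathlib

set_option maxSynthPendingDepth 3

/-- A set of paths of length two in the quiver `V`, given as a relation on arrows: `rel α β` says
that the path `αβ` belongs to the set.  It presents the quadratic monomial algebra `A = kQ/I`,
where `I` is the ideal generated by these paths.  The arrows of `V` are the elements `α` of
`Quiver.Total V`, with source `α.left` and target `α.right`. -/
structure QuadRel (V : Type*) [Quiver V] where
  rel : Quiver.Total V → Quiver.Total V → Prop
  composable : ∀ {α β}, rel α β → α.right = β.left

/-- Gentle presentations.  Since `I` is generated by paths of length two, for composable arrows
`αβ ∈ I` means `rel α β`. -/
structure QuadRel.IsGentle {V : Type*} [Quiver V] (R : QuadRel V) : Prop where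
  finite_vertices : Finite V
  finite_arrows : Finite (Quiver.Total V)
  rel_right_unique : ∀ α β β', R.rel α β → R.rel α β' → β = β'
  rel_left_unique : ∀ α γ γ', R.rel γ α → R.rel γ' α → γ = γ'
  nonrel_right_unique : ∀ α β β' : Quiver.Total V, α.right = β.left → ¬ R.rel α β →
    α.right = β'.left → ¬ R.rel α β' → β = β'
  nonrel_left_unique : ∀ α γ γ' : Quiver.Total V, γ.right = α.left → ¬ R.rel γ α →
    γ'.right = α.left → ¬ R.rel γ' α → γ = γ'
  two_outgoing : ∀ a : V, {α : Quiver.Total V | α.left = a}.encard ≤ 2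
  two_incoming : ∀ a : V, {α : Quiver.Total V | α.right = a}.encard ≤ 2

/-- The end point of the path that starts at a vertex and runs through a list of arrows. -/
def pathEnd {V : Type*} [Quiver V] : V → List (Quiver.Total V) → V
  | a, [] => a
  | _, α :: l => pathEnd α.right l

/-- The arrows in `l` form a path starting at `a` which is nonzero in `A = kQ/I`, that is, which
contains no path of `R`.  (The empty list gives the trivial path at `a`.) -/
def QuadRel.IsNonzeroPath {V : Type*} [Quiver V] (R : QuadRel V) (a : V)
    (l : List (Quiver.Total V)) : Prop :=
  (∀ α ∈ l.head?, α.left = a) ∧ l.IsChain (fun α β => α.right = β.left ∧ ¬ R.rel α β)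

/-- The nonzero paths of `A = kQ/I`, including the trivial ones. -/
structure NonzeroPath {V : Type*} [Quiver V] (R : QuadRel V) where
  src : V
  arrows : List (Quiver.Total V)
  nonzero : R.IsNonzeroPath src arrows

def NonzeroPath.tgt {V : Type*} [Quiver V] {R : QuadRel V} (p : NonzeroPath R) : V :=
  pathEnd p.src p.arrows

/-- The monomial algebra `A = kQ/I`, through its basis of nonzero paths. -/
abbrev QuadAlg (k : Type*) [Field k] {V : Type*} [Quiver V] (R : QuadRel V) :=
  NonzeroPath R →₀ k

noncomputable section

open Classical in
/-- The class in `A` of the path with first vertex `a` and list of arrows `l`; it is `0` when this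
is not a nonzero path. -/
def pathClass (k : Type*) [Field k] {V : Type*} [Quiver V] (R : QuadRel V) (a : V)
    (l : List (Quiver.Total V)) : QuadAlg k R :=
  if h : R.IsNonzeroPath a l then Finsupp.single ⟨a, l, h⟩ 1 else 0

/-- The class in `A` of an arrow. -/
def arrowClass (k : Type*) [Field k] {V : Type*} [Quiver V] (R : QuadRel V)
    (α : Quiver.Total V) : QuadAlg k R :=
  pathClass k R α.left [α]

/-- The Hochschild cochains `Hom_k(A ⊗ A, A)`; they have degree `1` in the shifted complex. -/
abbrev Cochain2 (k : Type*) [Field k] {V : Type*} [Quiver V] (R : QuadRel V) :=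
  QuadAlg k R →ₗ[k] QuadAlg k R →ₗ[k] QuadAlg k R

/-- The Hochschild cochains `Hom_k(A ⊗ A ⊗ A, A)`; they have degree `2` in the shifted complex. -/
abbrev Cochain3 (k : Type*) [Field k] {V : Type*} [Quiver V] (R : QuadRel V) :=
  QuadAlg k R →ₗ[k] QuadAlg k R →ₗ[k] QuadAlg k R →ₗ[k] QuadAlg k R

/-- The bilinear map with given values on pairs of nonzero paths. -/
def bilinOfPaths {k : Type*} [Field k] {V : Type*} [Quiver V] {R : QuadRel V}
    (g : NonzeroPath R → NonzeroPath R → QuadAlg k R) : Cochain2 k R :=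
  Finsupp.linearCombination k (fun p => Finsupp.linearCombination k (g p))

open Classical in
/-- The multiplication of `A`: concatenation of paths. -/
def pathMul (k : Type*) [Field k] {V : Type*} [Quiver V] (R : QuadRel V) : Cochain2 k R :=
  bilinOfPaths fun p q =>
    if p.tgt = q.src then pathClass k R p.src (p.arrows ++ q.arrows) else 0

/-- `f ∘ g = f (g ⊗ id - id ⊗ g)`, the Gerstenhaber product of two `2`-cochains. -/
def gerstProd {k : Type*} [Field k] {V : Type*} [Quiver V] {R : QuadRel V}
    (f g : Cochain2 k R) : Cochain3 k R :=
  g.compr₂ f -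
    ({ toFun := fun a => g.compr₂ (f a)
       map_add' := fun a b => by ext; simp
       map_smul' := fun c a => by ext; simp } : Cochain3 k R)

/-- The Gerstenhaber bracket of two `2`-cochains, `[f, g] = f ∘ g + g ∘ f`. -/
def gerstBracket {k : Type*} [Field k] {V : Type*} [Quiver V] {R : QuadRel V}
    (f g : Cochain2 k R) : Cochain3 k R :=
  gerstProd f g + gerstProd g f

/-- `B¹(A)[1] = Hom_{E-E}(k AP₂, A)`, where `AP₂` is the set of pairs `(α, β)` with `αβ = 0`, that
is `rel α β`: a map is given by its values on `AP₂` (extended by `0` to all pairs of arrows), and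
the value at `(α, β)` is a combination of nonzero paths parallel to `αβ`. -/
def BardzellOne (k : Type*) [Field k] {V : Type*} [Quiver V] (R : QuadRel V) :
    Submodule k (Quiver.Total V → Quiver.Total V → QuadAlg k R) where
  carrier := {f | ∀ α β, (¬ R.rel α β → f α β = 0) ∧
    ∀ p : NonzeroPath R, f α β p ≠ 0 → p.src = α.left ∧ p.tgt = β.right}
  zero_mem' := by
    intro α β
    simp
  add_mem' := by
    intro f g hf hg α β
    refine ⟨fun h => ?_, fun p hp => ?_⟩
    · have h₁ : f α β = 0 := (hf α β).1 h
      have h₂ : g α β = 0 := (hg α β).1 h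
      simp [h₁, h₂]
    by_cases h : f α β p = 0
    · refine (hg α β).2 p fun h' => hp ?_
      simp [h, h']
    · exact (hf α β).2 p h
  smul_mem' := by
    intro c f hf α β
    refine ⟨fun h => ?_, fun p hp => (hf α β).2 p fun h => hp ?_⟩
    · have h₁ : f α β = 0 := (hf α β).1 h
      simp [h₁]
    · simp [h]

/-- `G*` in degree `2`: `(G* f)(uα, βv) = u f(α, β) v` if `αβ = 0`, and `0` otherwise. -/
def bardzellG {k : Type*} [Field k] {V : Type*} [Quiver V] {R : QuadRel V}
    (f : BardzellOne k R) : Cochain2 k R :=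
  bilinOfPaths fun p q =>
    match p.arrows.getLast?, q.arrows with
    | some α, β :: v =>
        pathMul k R
          (pathMul k R (pathClass k R p.src p.arrows.dropLast) (f.1 α β))
          (pathClass k R β.right v)
    | _, _ => 0

open Classical in
/-- `H*` from `3`-cochains to `2`-cochains: for `p = β₁⋯βₘ` and `q = γ₁⋯γᵣ` of positive length,
`(H* v)(p, q) = Θ(βₘ, γ₁) v(β₁⋯βₘ₋₁, βₘ, γ₁) γ₂⋯γᵣ - ∑_{i=2}^r v(p, γ₁⋯γᵢ₋₁, γᵢ) γᵢ₊₁⋯γᵣ`,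
where `Θ(βₘ, γ₁)` is `1` if `βₘγ₁ = 0` and `0` otherwise.  (Below `j = i - 1`.) -/
def bardzellH {k : Type*} [Field k] {V : Type*} [Quiver V] {R : QuadRel V}
    (v : Cochain3 k R) : Cochain2 k R :=
  bilinOfPaths fun p q =>
    match p.arrows.getLast?, q.arrows with
    | some β, γ :: r =>
        (if R.rel β γ then
          pathMul k R
            (v (pathClass k R p.src p.arrows.dropLast) (arrowClass k R β) (arrowClass k R γ))
            (pathClass k R γ.right r)
        else 0) -
        ∑ j ∈ Finset.Ico 1 q.arrows.length,
          match q.arrows.drop j with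
          | δ :: s =>
              pathMul k R
                (v (pathClass k R p.src p.arrows) (pathClass k R q.src (q.arrows.take j))
                  (arrowClass k R δ))
                (pathClass k R δ.right s)
          | [] => 0
    | _, _ => 0

end

/-- `𝕊⁻_{t,n-t}`: the permutations `τ` with `τ(1) < ⋯ < τ(t)`, `τ(t+1) < ⋯ < τ(n)` and
`τ(1) < τ(t+1)`. -/
def unshuffles (n t : ℕ) : Finset (Equiv.Perm (Fin n)) :=
  Finset.univ.filter fun τ =>
    (∀ i j : Fin n, i < j → (j.val < t ∨ t ≤ i.val) → τ i < τ j) ∧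
    (∀ i j : Fin n, i.val = 0 → j.val = t → τ i < τ j)

/-- The antisymmetric Koszul sign of `τ` for homogeneous elements of degrees `d 1, …, d n`. -/
def koszulSign {n : ℕ} (d : Fin n → ℕ) (τ : Equiv.Perm (Fin n)) : ℤ :=
  (Equiv.Perm.sign τ : ℤ) *
    ∏ i : Fin n, ∏ j : Fin n, if i < j ∧ τ j < τ i then (-1) ^ (d (τ i) * d (τ j)) else 1

/-- `κ(τ)_t = (-1)^(t-1) (-1)^((n-t-1)(d(τ(1)) + ⋯ + d(τ(t))))`, for `1 ≤ t ≤ n - 1`. -/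
def kappaSign {n : ℕ} (d : Fin n → ℕ) (t : ℕ) (τ : Equiv.Perm (Fin n)) : ℤ :=
  (-1) ^ (t - 1) * (-1) ^ ((n - t - 1) * ∑ i : Fin n, if i.val < t then d (τ i) else 0)

noncomputable section

/-- `v_n(f₁, …, fₙ) = ∑_{t=1}^{n-1} ∑_{τ ∈ 𝕊⁻_{t,n-t}} χ(τ) κ(τ)_t
[φ_t(f_τ(1), …, f_τ(t)), φ_{n-t}(f_τ(t+1), …, f_τ(n))]` for elements `fᵢ` of degree `1`, in terms
of the maps `φ_m`, `m < n`.  The summation index `t` below runs from `0` to `n - 2`. -/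
def bardzellVStep {k : Type*} [Field k] {V : Type*} [Quiver V] {R : QuadRel V} (n : ℕ)
    (φ : (m : ℕ) → m < n → (Fin m → BardzellOne k R) → Cochain2 k R)
    (f : Fin n → BardzellOne k R) : Cochain3 k R :=
  ∑ t : Fin (n - 1), ∑ τ ∈ unshuffles n (t.val + 1),
    (koszulSign (fun _ => 1) τ * kappaSign (fun _ => 1) (t.val + 1) τ) •
      gerstBracket
        (φ (t.val + 1) (by omega) fun i => f (τ ⟨i.val, by omega⟩))
        (φ (n - (t.val + 1)) (by omega) fun i => f (τ ⟨t.val + 1 + i.val, by omega⟩))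

/-- The maps `φ_n` on `B¹(A)[1]`: `φ₁ = G*` and `φ_n = H* v_n` for `n ≥ 2`. -/
def bardzellPhi {k : Type*} [Field k] {V : Type*} [Quiver V] {R : QuadRel V} (n : ℕ)
    (f : Fin n → BardzellOne k R) : Cochain2 k R :=
  if h : n = 1 then bardzellG (f ⟨0, by omega⟩)
  else bardzellH (bardzellVStep n (fun m _ g => bardzellPhi m g) f)
termination_by n

/-- The maps `v_n` on `B¹(A)[1]`. -/
def bardzellV {k : Type*} [Field k] {V : Type*} [Quiver V] {R : QuadRel V} (n : ℕ)
    (f : Fin n → BardzellOne k R) : Cochain3 k R :=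
  bardzellVStep n (fun m _ g => bardzellPhi m g) f

open Classical in
/-- The brackets `l_n = F* v_n`, `n ≥ 2`, on `B¹(A)[1]`.  The value of `l_n` is the element of
`Hom_{E-E}(k AP₃, A)` whose value at `(α, β, γ) ∈ AP₃`, that is with `αβ = 0` and `βγ = 0`, is
`v_n(f₁, …, fₙ)(α ⊗ β ⊗ γ)` (extended by `0` to all triples of arrows). -/
def bardzellL {k : Type*} [Field k] {V : Type*} [Quiver V] {R : QuadRel V} (n : ℕ)
    (f : Fin n → BardzellOne k R) (α β γ : Quiver.Total V) : QuadAlg k R :=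
  if R.rel α β ∧ R.rel β γ then
    bardzellV n f (arrowClass k R α) (arrowClass k R β) (arrowClass k R γ)
  else 0

/-- `f` is the basis element `(αβ‖u)` of `B¹(A)[1]`, where `αβ = 0` and `u` is a nonzero path
parallel to `αβ`: its value at `(α, β)` is `u`, and its value at any other pair is `0`. -/
def IsBasisElement {k : Type*} [Field k] {V : Type*} [Quiver V] {R : QuadRel V}
    (f : BardzellOne k R) (α β : Quiver.Total V) (u : List (Quiver.Total V)) : Prop :=
  R.rel α β ∧ R.IsNonzeroPath α.left u ∧ pathEnd α.left u = β.right ∧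
    f.1 α β = pathClass k R α.left u ∧
    ∀ α' β', (α', β') ≠ (α, β) → f.1 α' β' = 0

end

/-- A subquiver of the shape (◇): vertices `1, …, 6`, arrows `α₁ : 1 → 2`, `α₂ : 2 → 3`,
`α₃ : 3 → 4`, `β₁ : 1 → 5`, `β₂ : 5 → 2`, `ε₁ : 2 → 6`, `lam : 5 → 6`, and a path
`eps = ε₂⋯ε_p` from `6` to `4`, such that `(α₁, α₂, α₃) ∈ AP₃`, `β₁β₂ ≠ 0` and `ε₁⋯ε_p ≠ 0`
in `A`. -/
structure Diamond {V : Type*} [Quiver V] (R : QuadRel V) where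
  (α₁ α₂ α₃ β₁ β₂ ε₁ lam : Quiver.Total V)
  eps : List (Quiver.Total V)
  rel₁₂ : R.rel α₁ α₂
  rel₂₃ : R.rel α₂ α₃
  β₁_left : β₁.left = α₁.left
  β₂_right : β₂.right = α₁.right
  β_nonzero : R.IsNonzeroPath α₁.left [β₁, β₂]
  lam_left : lam.left = β₁.right
  lam_right : lam.right = ε₁.right
  eps_ne_nil : eps ≠ []
  eps_nonzero : R.IsNonzeroPath α₁.right (ε₁ :: eps)
  eps_end : pathEnd α₁.right (ε₁ :: eps) = α₃.right
  vertices_distinct :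
    [α₁.left, α₁.right, α₂.right, α₃.right, β₁.right, ε₁.right].Nodup

/-! Each φ_n rewrites paths: φ₁ = G* replaces the zero relation at the junction of two paths by a
parallel path, and H* iterates such replacements. If two arrows are inserted into φ_n with n ≥ 2,
the sum in H* is empty and its leading term contains a trivial path, so φ_n vanishes
(`eq_one_of_bardzellPhi_arrowClass_ne_zero`). Hence on (α₁, α₂, α₃) ∈ AP₃ the bracket l₄ involves
only the terms φ₃(p, α₃) with p parallel to α₁α₂ and φ₃(α₁, q) with q parallel to α₂α₃.

Unwinding φ₃ and discarding the inner terms φ(x, γ) where xγ is a nonzero path leaves four patterns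
of successive replacements. In each of them the input paths, the parallel paths put in and the final
path are all nonzero. Gentleness makes the nonzero continuation of an arrow unique on either side
and bounds by two the arrows at a vertex; acyclicity, expressed by a rank function, excludes
returning paths; thinness identifies parallel arrows. Three patterns are thereby contradictory
(`not_replace_right_right`, `not_replace_right_right'`, `not_replace_right_left`), so φ₃(α₁, q) = 0.
The fourth is a term of φ₃(p, α₃) with p = Pbcα₂ and q = ε₁⋯ε_p, where cε₁ and then bl₁ are
replaced. It forces P to be trivial, cε₁ to be replaced by a single arrow l₁, and bl₁ by a path from
α₁ to ε₁: this is (◇) with β₁ = b, β₂ = c, λ = l₁ (`exists_diamond`).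

Conversely, gentleness forces β₂ε₁ and β₁λ into I (`Diamond.relations`), so the four basis elements
exist. In the sums defining v₄, v₃ and v₂ a single term survives on them, and it carries the sign -1
(`Diamond.bardzellL_eq`). -/

/-! ### Which paths can occur in the values of G*, H* and φ_n. -/

section Supports

variable {k : Type*} [Field k] {V : Type*} [Quiver V] {R : QuadRel V}

/-- The path of length one given by an arrow. -/
def NonzeroPath.ofArrow (R : QuadRel V) (α : Quiver.Total V) : NonzeroPath R :=
  ⟨α.left, [α], by simp [QuadRel.IsNonzeroPath]⟩

theorem NonzeroPath.ext' {p q : NonzeroPath R} (h₁ : p.src = q.src) (h₂ : p.arrows = q.arrows) :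
    p = q := by
  cases p
  cases q
  cases h₁
  cases h₂
  rfl

theorem pathClass_eq_single (p : NonzeroPath R) :
    pathClass k R p.src p.arrows = Finsupp.single p 1 := by
  simp [pathClass, p.nonzero]

theorem arrowClass_eq_single (α : Quiver.Total V) :
    arrowClass k R α = Finsupp.single (NonzeroPath.ofArrow R α) 1 :=
  pathClass_eq_single (NonzeroPath.ofArrow R α)

theorem of_pathClass_apply_ne_zero {a : V} {l : List (Quiver.Total V)} {r : NonzeroPath R}
    (h : pathClass k R a l r ≠ 0) : r.src = a ∧ r.arrows = l := by
  unfold pathClass at h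
  split_ifs at h with h'
  · obtain rfl : (⟨a, l, h'⟩ : NonzeroPath R) = r := by
      by_contra hne
      exact h (Finsupp.single_eq_of_ne' hne)
    exact ⟨rfl, rfl⟩
  · simp at h

theorem bilinOfPaths_single (g : NonzeroPath R → NonzeroPath R → QuadAlg k R)
    (p q : NonzeroPath R) :
    bilinOfPaths g (Finsupp.single p 1) (Finsupp.single q 1) = g p q := by
  simp [bilinOfPaths]

/-- A path in the support of `L x` comes from a path in the support of `x`. -/
theorem exists_of_map_apply_ne_zero {L : QuadAlg k R →ₗ[k] QuadAlg k R} {x : QuadAlg k R}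
    {r : NonzeroPath R} (h : L x r ≠ 0) : ∃ p, x p ≠ 0 ∧ L (Finsupp.single p 1) r ≠ 0 := by
  by_contra! hn
  refine h ?_
  have hx : L x = x.sum fun p c => c • L (Finsupp.single p 1) := by
    conv_lhs => rw [← Finsupp.sum_single x]
    rw [Finsupp.sum, map_sum]
    refine Finset.sum_congr rfl fun p _ => ?_
    dsimp only
    rw [← map_smul, Finsupp.smul_single_one]
  rw [hx, Finsupp.sum, Finsupp.finsetSum_apply]
  refine Finset.sum_eq_zero fun p hp => ?_
  rw [Finsupp.smul_apply, hn p (Finsupp.mem_support_iff.1 hp), smul_zero]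

theorem exists_of_pathMul_apply_ne_zero {x y : QuadAlg k R} {r : NonzeroPath R}
    (h : pathMul k R x y r ≠ 0) :
    ∃ p q : NonzeroPath R, x p ≠ 0 ∧ y q ≠ 0 ∧ p.tgt = q.src ∧ r.src = p.src ∧
      r.arrows = p.arrows ++ q.arrows := by
  obtain ⟨q, hq, h⟩ := exists_of_map_apply_ne_zero h
  obtain ⟨p, hp, h⟩ := exists_of_map_apply_ne_zero (L := (pathMul k R).flip _) h
  rw [LinearMap.flip_apply, pathMul, bilinOfPaths_single] at h
  split_ifs at h with hc
  · obtain ⟨h₁, h₂⟩ := of_pathClass_apply_ne_zero h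
    exact ⟨p, q, hp, hq, hc, h₁, h₂⟩
  · simp at h

theorem pathMul_single (p q : NonzeroPath R) (h : p.tgt = q.src) :
    pathMul k R (Finsupp.single p 1) (Finsupp.single q 1) =
      pathClass k R p.src (p.arrows ++ q.arrows) := by
  rw [pathMul, bilinOfPaths_single, if_pos h]

theorem gerstProd_apply (f g : Cochain2 k R) (a b c : QuadAlg k R) :
    gerstProd f g a b c = f (g a b) c - f a (g b c) := rfl

theorem gerstBracket_apply (f g : Cochain2 k R) (a b c : QuadAlg k R) :
    gerstBracket f g a b c = gerstProd f g a b c + gerstProd g f a b c := rfl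

theorem QuadRel.IsNonzeroPath.take {a : V} {l : List (Quiver.Total V)}
    (h : R.IsNonzeroPath a l) {j : ℕ} (hj : j ≠ 0) : R.IsNonzeroPath a (l.take j) := by
  refine ⟨?_, h.2.take j⟩
  rw [List.head?_take, if_neg hj]
  exact h.1

theorem QuadRel.IsNonzeroPath.dropLast {a : V} {l : List (Quiver.Total V)}
    (h : R.IsNonzeroPath a l) : R.IsNonzeroPath a l.dropLast := by
  refine ⟨fun α hα => h.1 α ?_, h.2.dropLast⟩
  rcases List.eq_nil_or_concat l with rfl | ⟨m, β, rfl⟩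
  · exact hα
  · simp at hα ⊢
    simp [hα]

/-- The support of `G* f`. -/
theorem exists_of_bardzellG_ne_zero {f : BardzellOne k R} {p q r : NonzeroPath R}
    (h : bardzellG f (Finsupp.single p 1) (Finsupp.single q 1) r ≠ 0) :
    ∃ (p' : List (Quiver.Total V)) (β γ : Quiver.Total V) (y : List (Quiver.Total V))
      (u : NonzeroPath R), p.arrows = p' ++ [β] ∧ q.arrows = γ :: y ∧ R.rel β γ ∧
      f.1 β γ u ≠ 0 ∧ u.src = β.left ∧ u.tgt = γ.right ∧ r.src = p.src ∧
      r.arrows = p' ++ (u.arrows ++ y) := by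
  rw [bardzellG, bilinOfPaths_single] at h
  split at h
  · rename_i β γ y hβ hγ
    obtain ⟨s, t, hs, ht, -, hrs, hrt⟩ := exists_of_pathMul_apply_ne_zero h
    obtain ⟨s', u, hs', hu, -, hss, hst⟩ := exists_of_pathMul_apply_ne_zero hs
    obtain ⟨h₁, h₂⟩ := of_pathClass_apply_ne_zero hs'
    obtain ⟨-, h₃⟩ := of_pathClass_apply_ne_zero ht
    have hf := f.2 β γ
    refine ⟨p.arrows.dropLast, β, γ, y, u, (List.dropLast_append_getLast? _ hβ).symm, hγ, ?_, hu,
      (hf.2 u hu).1, (hf.2 u hu).2, hrs.trans (hss.trans h₁), ?_⟩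
    · by_contra hR
      rw [hf.1 hR] at hu
      exact hu rfl
    · rw [hrt, hst, h₂, h₃, List.append_assoc]
  · simp at h

/-- The support of `H* v`. -/
theorem exists_of_bardzellH_ne_zero {v : Cochain3 k R} {p q r : NonzeroPath R}
    (h : bardzellH v (Finsupp.single p 1) (Finsupp.single q 1) r ≠ 0) :
    (∃ (p' : NonzeroPath R) (β γ : Quiver.Total V) (y : List (Quiver.Total V))
      (s : NonzeroPath R), p'.src = p.src ∧ p.arrows = p'.arrows ++ [β] ∧ q.arrows = γ :: y ∧
      R.rel β γ ∧ v (Finsupp.single p' 1) (arrowClass k R β) (arrowClass k R γ) s ≠ 0 ∧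
      r.src = s.src ∧ r.arrows = s.arrows ++ y) ∨
    (∃ (x : NonzeroPath R) (γ : Quiver.Total V) (y : List (Quiver.Total V)),
      x.src = q.src ∧ x.arrows ≠ [] ∧ q.arrows = x.arrows ++ γ :: y ∧
      pathMul k R (v (Finsupp.single p 1) (Finsupp.single x 1) (arrowClass k R γ))
        (pathClass k R γ.right y) r ≠ 0) := by
  rw [bardzellH, bilinOfPaths_single] at h
  split at h
  · rename_i β γ y hβ hγ
    rw [Finsupp.sub_apply] at h
    by_cases h₁ : (if R.rel β γ then pathMul k R (v (pathClass k R p.src p.arrows.dropLast)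
        (arrowClass k R β) (arrowClass k R γ)) (pathClass k R γ.right y) else 0 : QuadAlg k R) r = 0
    · right
      rw [h₁, zero_sub, neg_ne_zero, Finsupp.finsetSum_apply] at h
      obtain ⟨j, hj, h⟩ := Finset.exists_ne_zero_of_sum_ne_zero h
      obtain ⟨hj₁, hj₂⟩ := Finset.mem_Ico.1 hj
      split at h
      · rename_i δ y' hδ
        refine ⟨⟨q.src, q.arrows.take j, q.nonzero.take (by omega)⟩, δ, y', rfl, ?_, ?_, ?_⟩
        · intro h0
          have := congrArg List.length h0
          simp at this
          grind
        · rw [← hδ, List.take_append_drop]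
        · rw [← pathClass_eq_single, ← pathClass_eq_single]
          exact h
      · simp at h
    · left
      split_ifs at h₁ with hR
      · obtain ⟨s, t, hs, ht, -, hrs, hrt⟩ := exists_of_pathMul_apply_ne_zero h₁
        obtain ⟨-, h₃⟩ := of_pathClass_apply_ne_zero ht
        refine ⟨⟨p.src, p.arrows.dropLast, p.nonzero.dropLast⟩, β, γ, y, s, rfl,
          (List.dropLast_append_getLast? _ hβ).symm, hγ, hR, ?_, hrs, by rw [hrt, h₃]⟩
        rw [← pathClass_eq_single]
        exact hs
      · simp at h₁
  · simp at h

theorem bardzellPhi_one (f : Fin 1 → BardzellOne k R) : bardzellPhi 1 f = bardzellG (f 0) := by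
  rw [bardzellPhi, dif_pos rfl]
  rfl

theorem bardzellPhi_of_ne_one {n : ℕ} (hn : n ≠ 1) (f : Fin n → BardzellOne k R) :
    bardzellPhi n f = bardzellH (bardzellV n f) := by
  rw [bardzellPhi, dif_neg hn]
  rfl

/-- `φ_n` vanishes when its first argument is a trivial path. -/
theorem bardzellPhi_single_of_arrows_eq_nil {n : ℕ} (f : Fin n → BardzellOne k R)
    {p : NonzeroPath R} (hp : p.arrows = []) : bardzellPhi n f (Finsupp.single p 1) = 0 := by
  refine Finsupp.lhom_ext' fun q => LinearMap.ext_ring ?_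
  by_cases hn : n = 1
  · subst hn
    simp [bardzellPhi_one, bardzellG, bilinOfPaths_single, hp]
  · simp [bardzellPhi_of_ne_one hn, bardzellH, bilinOfPaths_single, hp]

/-- If `φ_n` does not vanish on a path and an arrow, the last arrow of the path and the arrow form
a relation. -/
theorem exists_of_bardzellPhi_arrowClass_ne_zero {n : ℕ} {f : Fin n → BardzellOne k R}
    {p : NonzeroPath R} {γ : Quiver.Total V}
    (h : bardzellPhi n f (Finsupp.single p 1) (arrowClass k R γ) ≠ 0) :
    ∃ p' β, p.arrows = p' ++ [β] ∧ R.rel β γ := by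
  obtain ⟨r, hr⟩ := Finsupp.ne_iff.1 h
  rw [arrowClass_eq_single] at hr
  by_cases hn : n = 1
  · subst hn
    rw [bardzellPhi_one] at hr
    obtain ⟨p', β, γ', y, u, hp, hq, hR, -⟩ := exists_of_bardzellG_ne_zero hr
    obtain ⟨rfl, -⟩ := List.cons.inj hq
    exact ⟨p', β, hp, hR⟩
  · rw [bardzellPhi_of_ne_one hn] at hr
    rcases exists_of_bardzellH_ne_zero hr with
      ⟨p', β, γ', y, u, -, hp, hq, hR, -⟩ | ⟨x, γ', y, -, hx, hq, -⟩
    · obtain ⟨rfl, -⟩ := List.cons.inj hq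
      exact ⟨_, β, hp, hR⟩
    · exfalso
      have := congrArg List.length hq
      have hx' := List.length_pos_iff.2 hx
      simp [NonzeroPath.ofArrow] at this
      omega

/-- `v_n` is a combination of Gerstenhaber products `φ_m ∘ φ_{n-m}`. -/
theorem exists_of_bardzellV_ne_zero {n : ℕ} {f : Fin n → BardzellOne k R} {a b c : QuadAlg k R}
    {r : NonzeroPath R} (h : bardzellV n f a b c r ≠ 0) :
    ∃ (m m' : ℕ) (g : Fin m → BardzellOne k R) (g' : Fin m' → BardzellOne k R),
      1 ≤ m ∧ 1 ≤ m' ∧ m + m' = n ∧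
      gerstProd (bardzellPhi m g) (bardzellPhi m' g') a b c r ≠ 0 := by
  simp only [bardzellV, bardzellVStep, LinearMap.sum_apply, Finsupp.finsetSum_apply] at h
  obtain ⟨t, -, h⟩ := Finset.exists_ne_zero_of_sum_ne_zero h
  obtain ⟨τ, -, h⟩ := Finset.exists_ne_zero_of_sum_ne_zero h
  have ht := t.2
  rw [LinearMap.smul_apply, LinearMap.smul_apply, LinearMap.smul_apply, Finsupp.smul_apply,
    gerstBracket_apply, Finsupp.add_apply] at h
  have h' := right_ne_zero_of_smul h
  by_cases h₀ : gerstProd (bardzellPhi (t.val + 1) fun i => f (τ ⟨i.val, by omega⟩))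
      (bardzellPhi (n - (t.val + 1)) fun i => f (τ ⟨t.val + 1 + i.val, by omega⟩)) a b c r = 0
  · rw [h₀, zero_add] at h'
    exact ⟨_, _, _, _, by omega, by omega, by omega, h'⟩
  · exact ⟨_, _, _, _, by omega, by omega, by omega, h₀⟩

/-- On two arrows only `φ₁` can be nonzero. -/
theorem eq_one_of_bardzellPhi_arrowClass_ne_zero {n : ℕ} {f : Fin n → BardzellOne k R}
    {β γ : Quiver.Total V} (h : bardzellPhi n f (arrowClass k R β) (arrowClass k R γ) ≠ 0) :
    n = 1 := by
  by_contra hn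
  obtain ⟨r, hr⟩ := Finsupp.ne_iff.1 h
  rw [arrowClass_eq_single, arrowClass_eq_single, bardzellPhi_of_ne_one hn] at hr
  rcases exists_of_bardzellH_ne_zero hr with
    ⟨p', β', γ', y, u, -, hp, -, -, hv, -⟩ | ⟨x, γ', y, -, hx, hq, -⟩
  -- Removing the last arrow from a single arrow leaves a trivial path, and every Gerstenhaber
  -- product in v_n vanishes on a trivial first argument and two arrows.
  · have hp' : p'.arrows = [] := by
      have := congrArg List.length hp
      simpa [NonzeroPath.ofArrow] using this
    obtain ⟨m, m', g, g', -, -, -, h⟩ := exists_of_bardzellV_ne_zero hv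
    rw [gerstProd_apply, bardzellPhi_single_of_arrows_eq_nil _ hp',
      bardzellPhi_single_of_arrows_eq_nil _ hp'] at h
    simp at h
  · have := congrArg List.length hq
    have hx' := List.length_pos_iff.2 hx
    simp [NonzeroPath.ofArrow] at this
    omega

end Supports

/-! ### Paths in a gentle quiver: unique continuation and ranks. -/

section Combinatorics

variable {V : Type*} [Quiver V] {R : QuadRel V}

/-- `l` is the list of arrows of a nonzero path from `a` to `b`. -/
def QuadRel.Joins (R : QuadRel V) (a : V) (l : List (Quiver.Total V)) (b : V) : Prop :=
  R.IsNonzeroPath a l ∧ pathEnd a l = b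

theorem QuadRel.joins_nil {a b : V} : R.Joins a [] b ↔ a = b := by
  simp [QuadRel.Joins, QuadRel.IsNonzeroPath, pathEnd]

theorem QuadRel.joins_cons {a b : V} {α : Quiver.Total V} {l : List (Quiver.Total V)} :
    R.Joins a (α :: l) b ↔
      α.left = a ∧ R.Joins α.right l b ∧ ∀ β ∈ l.head?, ¬ R.rel α β := by
  cases l with
  | nil => simp [QuadRel.Joins, QuadRel.IsNonzeroPath, pathEnd]
  | cons β l =>
    simp only [QuadRel.Joins, QuadRel.IsNonzeroPath, pathEnd, List.isChain_cons_cons,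
      List.head?_cons, Option.mem_def, Option.some.injEq, forall_eq']
    grind

theorem QuadRel.joins_append {l m : List (Quiver.Total V)} {a b : V} :
    R.Joins a (l ++ m) b ↔ ∃ c, R.Joins a l c ∧ R.Joins c m b ∧
      ∀ α ∈ l.getLast?, ∀ β ∈ m.head?, ¬ R.rel α β := by
  induction l generalizing a with
  | nil => simp [QuadRel.joins_nil]
  | cons α l ih =>
    rw [List.cons_append, QuadRel.joins_cons, ih]
    cases l with
    | nil => simp [QuadRel.joins_cons, QuadRel.joins_nil]
    | cons β l =>
      simp only [QuadRel.joins_cons (α := α), List.getLast?_cons_cons, List.cons_append,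
        List.head?_cons]
      grind

theorem QuadRel.joins_concat {a b : V} {α : Quiver.Total V} {l : List (Quiver.Total V)} :
    R.Joins a (l ++ [α]) b ↔
      R.Joins a l α.left ∧ α.right = b ∧ ∀ β ∈ l.getLast?, ¬ R.rel β α := by
  rw [QuadRel.joins_append]
  simp [QuadRel.joins_cons, QuadRel.joins_nil]

/-- A gentle presentation on a quiver without oriented cycles and parallel arrows; the absence of
oriented cycles is witnessed by a function that increases along arrows. -/
structure QuadRel.IsRanked (R : QuadRel V) (rk : V → ℕ) : Prop where
  gentle : R.IsGentle
  lt : ∀ α : Quiver.Total V, rk α.left < rk α.right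
  thin : ∀ α β : Quiver.Total V, α.left = β.left → α.right = β.right → α = β

theorem QuadRel.exists_isRanked (gentle : R.IsGentle)
    (acyclic : ∀ (a : V) (p : Quiver.Path a a), p.length = 0) (thin : Quiver.IsThin V) :
    ∃ rk, R.IsRanked rk := by
  have := gentle.finite_vertices
  -- The rank of v counts the vertices from which v can be reached. It grows strictly along α, since
  -- otherwise the target of α would reach its source and close a cycle.
  refine ⟨fun v => {w | Nonempty (Quiver.Path w v)}.ncard, gentle, fun α => ?_, ?_⟩
  · refine Set.ncard_lt_ncard ⟨?_, fun h => ?_⟩ (Set.toFinite _)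
    · rintro w ⟨p⟩
      exact ⟨p.cons α.hom⟩
    · obtain ⟨p⟩ := h (show α.right ∈ _ from ⟨Quiver.Path.nil⟩)
      simpa using acyclic _ (p.cons α.hom)
  · rintro ⟨a, b, f⟩ ⟨a', b', g⟩ h h'
    obtain rfl : a = a' := h
    obtain rfl : b = b' := h'
    have := thin a b
    rw [Subsingleton.elim f g]

theorem eq_or_eq_of_encard_le_two {X : Type*} {s : Set X} (hs : s.encard ≤ 2) {a b c : X}
    (ha : a ∈ s) (hb : b ∈ s) (hc : c ∈ s) (hab : a ≠ b) : c = a ∨ c = b := by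
  by_contra! h
  have h3 : ({a, b, c} : Set X).encard = 3 :=
    Set.encard_eq_three.2 ⟨a, b, c, hab, h.1.symm, h.2.symm, rfl⟩
  have h2 := (Set.encard_le_encard (show ({a, b, c} : Set X) ⊆ s by
    rintro x (rfl | rfl | rfl) <;> assumption)).trans hs
  rw [h3] at h2
  exact absurd h2 (by norm_num)

namespace QuadRel.IsRanked

variable {rk : V → ℕ}

theorem le (h : R.IsRanked rk) {a b : V} {l : List (Quiver.Total V)} (hl : R.Joins a l b) :
    rk a + l.length ≤ rk b := by
  induction l generalizing a with
  | nil => simp [QuadRel.joins_nil.1 hl]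
  | cons α l ih =>
    obtain ⟨rfl, h', -⟩ := QuadRel.joins_cons.1 hl
    have := ih h'
    have := h.lt α
    simp only [List.length_cons]
    omega

/-- The form in which acyclicity is mostly used below: closed or descending paths collapse. -/
theorem eq_nil (h : R.IsRanked rk) {a b : V} {l : List (Quiver.Total V)} (hl : R.Joins a l b)
    (hab : rk b ≤ rk a) : l = [] ∧ a = b := by
  have := h.le hl
  obtain rfl : l = [] := List.length_eq_zero_iff.1 (by omega)
  exact ⟨rfl, QuadRel.joins_nil.1 hl⟩

end QuadRel.IsRanked

namespace QuadRel

theorem Joins.exists_cons {a b : V} {l : List (Quiver.Total V)}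
    (hl : R.Joins a l b) (hab : a ≠ b) : ∃ α m, l = α :: m := by
  cases l with
  | nil => exact absurd (joins_nil.1 hl) hab
  | cons α m => exact ⟨α, m, rfl⟩

theorem Joins.exists_concat {a b : V} {l : List (Quiver.Total V)}
    (hl : R.Joins a l b) (hab : a ≠ b) : ∃ m α, l = m ++ [α] := by
  rcases List.eq_nil_or_concat l with rfl | ⟨m, α, rfl⟩
  · exact absurd (joins_nil.1 hl) hab
  · exact ⟨m, α, by simp⟩

theorem Joins.consecutive {a z : V} {P T : List (Quiver.Total V)} {x y : Quiver.Total V}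
    (hl : R.Joins a (P ++ x :: y :: T) z) : x.right = y.left ∧ ¬ R.rel x y := by
  obtain ⟨c, -, h, -⟩ := joins_append.1 hl
  obtain ⟨-, h, h'⟩ := joins_cons.1 h
  exact ⟨(joins_cons.1 h).1.symm, h' y rfl⟩

theorem Joins.head_left {a z : V} {T : List (Quiver.Total V)} {x : Quiver.Total V}
    (hl : R.Joins a (x :: T) z) : x.left = a := (joins_cons.1 hl).1

theorem Joins.tail {a z : V} {T : List (Quiver.Total V)} {x : Quiver.Total V}
    (hl : R.Joins a (x :: T) z) : R.Joins x.right T z := (joins_cons.1 hl).2.1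

theorem Joins.last_right {a z : V} {T : List (Quiver.Total V)} {x : Quiver.Total V}
    (hl : R.Joins a (T ++ [x]) z) : x.right = z := (joins_concat.1 hl).2.1

theorem Joins.init {a z : V} {T : List (Quiver.Total V)} {x : Quiver.Total V}
    (hl : R.Joins a (T ++ [x]) z) : R.Joins a T x.left := (joins_concat.1 hl).1

/-- The path up to the arrow `x`, and the path after it. -/
theorem Joins.split {a z : V} {P T : List (Quiver.Total V)} {x : Quiver.Total V}
    (hl : R.Joins a (P ++ x :: T) z) : R.Joins a P x.left ∧ R.Joins x.right T z := by
  obtain ⟨c, h₁, h, -⟩ := joins_append.1 hl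
  obtain ⟨rfl, h, -⟩ := joins_cons.1 h
  exact ⟨h₁, h⟩

/-- If a nonempty path can be continued by `b` and by `m`, then `m = b`. -/
theorem IsGentle.first_eq (g : R.IsGentle) {a a' z z' : V} {P T M : List (Quiver.Total V)}
    {b m : Quiver.Total V} (hP : P ≠ []) (h₁ : R.Joins a (P ++ b :: T) z)
    (h₂ : R.Joins a' (P ++ m :: M) z') : m = b := by
  rcases List.eq_nil_or_concat P with rfl | ⟨P', x, rfl⟩
  · exact absurd rfl hP
  · simp only [List.concat_eq_append, List.append_assoc, List.cons_append,
      List.nil_append] at h₁ h₂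
    obtain ⟨h₃, h₄⟩ := h₁.consecutive
    obtain ⟨h₅, h₆⟩ := h₂.consecutive
    exact g.nonrel_right_unique x m b h₅ h₆ h₃ h₄

/-- If a nonempty path can be preceded by `b` and by `m`, then `m = b`. -/
theorem IsGentle.last_eq (g : R.IsGentle) {a a' z z' : V} {E T M : List (Quiver.Total V)}
    {b m : Quiver.Total V} (hE : E ≠ []) (h₁ : R.Joins a (T ++ b :: E) z)
    (h₂ : R.Joins a' (M ++ m :: E) z') : m = b := by
  cases E with
  | nil => exact absurd rfl hE
  | cons x E =>
    obtain ⟨h₃, h₄⟩ := h₁.consecutive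
    obtain ⟨h₅, h₆⟩ := h₂.consecutive
    exact g.nonrel_left_unique x m b h₅ h₆ h₃ h₄

theorem IsGentle.eq_or_eq_of_left (g : R.IsGentle) {α β γ : Quiver.Total V}
    (h : α ≠ β) (h₁ : β.left = α.left) (h₂ : γ.left = α.left) : γ = α ∨ γ = β :=
  eq_or_eq_of_encard_le_two (g.two_outgoing α.left) rfl h₁ h₂ h

theorem IsGentle.eq_or_eq_of_right (g : R.IsGentle) {α β γ : Quiver.Total V}
    (h : α ≠ β) (h₁ : β.right = α.right) (h₂ : γ.right = α.right) : γ = α ∨ γ = β :=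
  eq_or_eq_of_encard_le_two (g.two_incoming α.right) rfl h₁ h₂ h

namespace IsRanked

variable {rk : V → ℕ}

/-- A path parallel to `b l ∈ I` cannot both start with `b` and end with `l`. -/
theorem not_joins_both (h : R.IsRanked rk) {b l : Quiver.Total V}
    {μ' μ'' : List (Quiver.Total V)} (hbl : R.rel b l) (hμ : R.Joins b.left (b :: μ') l.right)
    (he : b :: μ' = μ'' ++ [l]) : False := by
  have hc := R.composable hbl
  have hl := h.lt l
  have h₁ := hμ.tail
  obtain ⟨ν, m, rfl⟩ := Joins.exists_concat h₁ (by intro h; rw [← hc, h] at hl; omega)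
  rw [← List.cons_append] at he
  obtain ⟨rfl, hm⟩ := List.append_inj' he rfl
  obtain rfl : m = l := by simpa using hm
  -- Between b and l the path runs from the end of b to the start of l, which are the same vertex;
  -- so it is bl, which is zero.
  obtain ⟨rfl, -⟩ := h.eq_nil h₁.init (by rw [hc])
  exact (Joins.consecutive (P := []) hμ).2 hbl

/-- Replacing `l e ∈ I` by a parallel path `μ` in `S l e E` gives zero in the situations met
below. -/
theorem not_joins_replace_end (h : R.IsRanked rk) {l e δ : Quiver.Total V} {a a' z z' : V}
    {S μ E : List (Quiver.Total V)} (hle : R.rel l e) (hE : R.Joins e.left (e :: E) δ.right)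
    (hδ : rk δ.left < rk e.left) (hμ : R.Joins l.left μ e.right) (hS : S ≠ [])
    (hl : R.Joins a (S ++ [l]) z) (hr : R.Joins a' (S ++ (μ ++ E)) z') : False := by
  have hc := R.composable hle
  have he := h.lt e
  have hll := h.lt l
  obtain ⟨m, M, rfl⟩ := Joins.exists_cons hμ (by intro h; rw [h, hc] at hll; omega)
  -- S is nonempty and Sl is nonzero, so l is the only possible continuation of S: μ begins with l.
  obtain rfl := h.gentle.first_eq hS hl hr
  obtain ⟨N, n, hN⟩ := Joins.exists_concat hμ.tail (by intro h; rw [← hc, h] at he; omega)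
  subst hN
  have hne : n ≠ e := by
    rintro rfl
    exact h.not_joins_both hle hμ (List.cons_append ..).symm
  -- If E is empty, then δ, e and n end at one vertex, so n = δ, and μ would descend from the end of
  -- l, which is the start of e, to the start of δ. If E is nonempty, its first arrow has only one
  -- nonzero predecessor, so n = e.
  rcases E with _ | ⟨ε, E⟩
  · have h₁ := joins_nil.1 hE.tail
    have h₂ := hμ.tail.last_right
    rcases h.gentle.eq_or_eq_of_right (α := δ) (β := e) (γ := n)
      (by rintro rfl; omega) h₁ (h₂.trans h₁) with rfl | rfl
    · have := h.le hμ.tail.init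
      rw [hc] at this
      omega
    · exact hne rfl
  · refine hne (h.gentle.last_eq (T := []) (M := S ++ m :: N) (E := ε :: E) (by simp) hE (z' := z')
      (a' := a') ?_)
    simpa using hr

end IsRanked
end QuadRel
end Combinatorics

/-! ### The four patterns of successive replacements. -/

section Configurations

variable {V : Type*} [Quiver V] {R : QuadRel V} {rk : V → ℕ}

theorem exists_eq_concat {X : Type*} {l : List X} (hl : l ≠ []) : ∃ m x, l = m ++ [x] :=
  ⟨l.dropLast, l.getLast hl, (List.dropLast_append_getLast hl).symm⟩

namespace QuadRel.IsRanked

/-- No nonzero term arises by replacing `c ε₁` by `lam` and then the last arrow of `lam`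
together with `ε₂` by `μ`. -/
theorem not_replace_right_right (h : R.IsRanked rk) {α₁ α₂ α₃ c ε₁ ε₂ l : Quiver.Total V}
    {P ε lam S μ : List (Quiver.Total V)} {z z' : V} (h₁₂ : R.rel α₁ α₂) (h₂₃ : R.rel α₂ α₃)
    (hp : R.Joins α₁.left (P ++ [c, α₂]) α₂.right)
    (hq : R.Joins α₁.right (ε₁ :: ε₂ :: ε) α₃.right)
    (hc : R.rel c ε₁) (hlam : R.Joins c.left lam ε₁.right)
    (hS : R.Joins α₁.left (P ++ lam) z) (hSl : P ++ lam = S ++ [l]) (hl : R.rel l ε₂)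
    (hμ : R.Joins l.left μ ε₂.right) (hr : R.Joins α₁.left (S ++ (μ ++ ε)) z') : False := by
  have g := h.gentle
  have e₁₂ := R.composable h₁₂
  have e₂₃ := R.composable h₂₃
  have ec := R.composable hc
  obtain ⟨ecα, hcα⟩ := hp.consecutive
  have r₁ := h.lt α₁
  have r₂ := h.lt α₂
  have r₃ := h.lt α₃
  have rc := h.lt c
  have rε₁ := h.lt ε₁
  have eε : ε₁.right = ε₂.left := (Joins.consecutive (P := []) hq).1
  -- With P empty, c would be parallel to α₁, hence equal to it, although α₁α₂ = 0 and cα₂ ≠ 0.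
  have hP : P ≠ [] := by
    rintro rfl
    exact hcα (h.thin c α₁ hp.head_left (ecα.trans e₁₂.symm) ▸ h₁₂)
  obtain ⟨l₁, lam', rfl⟩ := Joins.exists_cons hlam (by grind)
  obtain rfl := g.first_eq hP hp hS
  have hlam' := hlam.tail
  obtain ⟨l₂, lam'', rfl⟩ := Joins.exists_cons hlam' (by grind)
  obtain rfl : l₂ = α₂ := by
    obtain ⟨h₃, h₄⟩ := Joins.consecutive (P := []) hlam
    exact g.nonrel_right_unique _ _ _ h₃ h₄ ecα hcα
  have hlam'' := hlam'.tail
  have h36 : l₂.right ≠ ε₁.right := by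
    intro h'
    exact hcα (h.thin l₂ ε₁ (ecα.symm.trans ec) h' ▸ hc)
  have r36 := h.le hlam''
  obtain ⟨Λ, x, rfl⟩ := Joins.exists_concat hlam'' h36
  have hS' : S = P ++ l₁ :: l₂ :: Λ ∧ l = x := by
    have : (P ++ l₁ :: l₂ :: Λ) ++ [x] = S ++ [l] := by simpa using hSl
    obtain ⟨h₁, h₂⟩ := List.append_inj' this rfl
    exact ⟨h₁.symm, by simpa using h₂.symm⟩
  obtain ⟨rfl, rfl⟩ := hS'
  refine h.not_joins_replace_end hl (E := ε) (δ := α₃) (eε ▸ hq.tail) ?_ hμ (by simp)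
    (hSl ▸ hS) hr
  rw [← e₂₃, ← eε]
  simp at r36
  omega

/-- No nonzero term arises by replacing `b γ₂` by `lam` and then the last arrow of `lam`
together with `γ₃` by `μ`. -/
theorem not_replace_right_right' (h : R.IsRanked rk) {α₁ α₂ α₃ b γ₂ γ₃ l : Quiver.Total V}
    {P γ lam S μ : List (Quiver.Total V)} {z z' : V} (h₁₂ : R.rel α₁ α₂) (h₂₃ : R.rel α₂ α₃)
    (hp : R.Joins α₁.left (P ++ [b]) α₂.right)
    (hq : R.Joins α₁.right (α₂ :: γ₂ :: γ₃ :: γ) α₃.right)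
    (hb : R.rel b γ₂) (hlam : R.Joins b.left lam γ₂.right)
    (hS : R.Joins α₁.left (P ++ lam) z) (hSl : P ++ lam = S ++ [l]) (hl : R.rel l γ₃)
    (hμ : R.Joins l.left μ γ₃.right) (hr : R.Joins α₁.left (S ++ (μ ++ γ)) z') : False := by
  have g := h.gentle
  have e₁₂ := R.composable h₁₂
  have e₂₃ := R.composable h₂₃
  have eb := R.composable hb
  have r₁ := h.lt α₁
  have r₂ := h.lt α₂
  have r₃ := h.lt α₃
  have rb := h.lt b
  have rγ₂ := h.lt γ₂
  have rγ₃ := h.lt γ₃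
  obtain ⟨eγ₂, hγ₂⟩ := Joins.consecutive (P := []) hq
  obtain ⟨eγ₃, -⟩ := Joins.consecutive (P := []) hq.tail
  have r74 := h.le hq.tail.tail
  have eb' : b.right = α₂.right := hp.last_right
  have hγα : α₃ ≠ γ₂ := by rintro rfl; exact hγ₂ h₂₃
  obtain ⟨l₁, lam', rfl⟩ := Joins.exists_cons hlam (by grind)
  have hlam' := hlam.tail
  -- If lam began with b, its next arrow would leave the end of α₂, hence be α₃ or γ₂. The first
  -- overshoots, because γ₂ ends strictly below the end of α₃; the second contradicts bγ₂ = 0.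
  have hl₁ : l₁ ≠ b := by
    rintro rfl
    obtain ⟨l₂, lam'', rfl⟩ := Joins.exists_cons hlam' (by grind)
    obtain ⟨h₃, h₄⟩ := Joins.consecutive (P := []) hlam
    rcases g.eq_or_eq_of_left hγα (eγ₂.symm.trans e₂₃) (h₃.symm.trans (eb'.trans e₂₃)) with
      rfl | rfl
    · have := h.le hlam'.tail
      simp at r74
      omega
    · exact h₄ hb
  obtain rfl : P = [] := by
    by_contra hP
    exact hl₁ (g.first_eq hP hp hS)
  have eb1 : b.left = α₁.left := hp.head_left
  obtain rfl : l₁ = α₁ := by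
    rcases g.eq_or_eq_of_left (α := α₁) (β := b) (γ := l₁) (by grind) eb1 hS.head_left with h' | h'
    · exact h'
    · exact absurd h' hl₁
  obtain ⟨Λ, x, rfl⟩ := Joins.exists_concat hlam' (by grind)
  have hS' : S = l₁ :: Λ ∧ l = x := by
    have : (l₁ :: Λ) ++ [x] = S ++ [l] := by simpa using hSl
    obtain ⟨h₁, h₂⟩ := List.append_inj' this rfl
    exact ⟨h₁.symm, by simpa using h₂.symm⟩
  obtain ⟨rfl, rfl⟩ := hS'
  refine h.not_joins_replace_end hl (E := γ) (δ := α₃) (eγ₃ ▸ hq.tail.tail) ?_ hμ (by simp)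
    (hSl ▸ hS) hr
  rw [← e₂₃, ← eγ₃, eγ₂]
  omega

/-- No nonzero term arises by replacing `c γ₂` by `l₁ lam` and then `b l₁` by `μ`, if the second
path starts with `α₂ γ₂`. -/
theorem not_replace_right_left (h : R.IsRanked rk) {α₁ α₂ α₃ b c γ₂ l₁ : Quiver.Total V}
    {P γ lam μ : List (Quiver.Total V)} {z : V} (h₁₂ : R.rel α₁ α₂) (h₂₃ : R.rel α₂ α₃)
    (hp : R.Joins α₁.left (P ++ [b, c]) α₂.right)
    (hq : R.Joins α₁.right (α₂ :: γ₂ :: γ) α₃.right)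
    (hc : R.rel c γ₂) (hlam : R.Joins c.left (l₁ :: lam) γ₂.right) (hb : R.rel b l₁)
    (hμ : R.Joins b.left μ l₁.right)
    (hr : R.Joins α₁.left (P ++ (μ ++ (lam ++ γ))) z) : False := by
  have g := h.gentle
  have e₁₂ := R.composable h₁₂
  have e₂₃ := R.composable h₂₃
  have ec := R.composable hc
  have eb := R.composable hb
  have r₁ := h.lt α₁
  have r₂ := h.lt α₂
  have r₃ := h.lt α₃
  have rb := h.lt b
  have rc := h.lt c
  have rγ₂ := h.lt γ₂
  have rl₁ := h.lt l₁
  obtain ⟨eγ₂, hγ₂⟩ := Joins.consecutive (P := []) hq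
  obtain ⟨ebc, hbc⟩ := hp.consecutive
  have ec' : c.right = α₂.right := Joins.last_right (T := P ++ [b]) (by simpa using hp)
  have hcα : c ≠ α₂ := by rintro rfl; exact hγ₂ hc
  have hl₁c : l₁ ≠ c := by rintro rfl; exact hbc hb
  have hp₁ := hp.split.1
  have rP := h.le hp₁
  -- Were γ₂ the last arrow, it would be parallel to α₃, but α₂γ₂ ≠ 0 and α₂α₃ = 0.
  obtain ⟨γ₃, γ, rfl⟩ := Joins.exists_cons hq.tail.tail (by
    intro h'
    exact hγ₂ (h.thin γ₂ α₃ (eγ₂.symm.trans e₂₃) h' ▸ h₂₃))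
  obtain ⟨m₁, μ₁, rfl⟩ := Joins.exists_cons hμ (by grind)
  have hbα : P = [] → α₁ ≠ b := by
    rintro - rfl
    exact hcα (h.thin c α₂ (ebc.symm.trans e₁₂) ec')
  -- A nonempty P can only be continued by b; if P is empty, α₁ and b are the only arrows leaving
  -- the source.
  have hm₁ : m₁ ≠ b → P = [] ∧ m₁ = α₁ := by
    intro hm
    have hP : P = [] := by
      by_contra hP
      exact hm (g.first_eq hP hp hr)
    subst hP
    refine ⟨rfl, ?_⟩
    rcases g.eq_or_eq_of_left (hbα rfl) hp.head_left
      (hr.head_left) with h' | h'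
    · exact h'
    · exact absurd h' hm
  -- Reading backwards from γ₃: if lam is empty, μ ends with α₂γ₂; otherwise l₁lam ends with α₂γ₂
  -- and μ ends with l₁.
  rcases lam with _ | ⟨l₂, lam⟩
  · have el₁ : l₁.right = γ₂.right := joins_nil.1 hlam.tail
    obtain ⟨M, m, hM⟩ := Joins.exists_concat hμ (by grind)
    rw [hM] at hμ hr
    obtain rfl : m = γ₂ := by
      refine g.last_eq (T := [α₂]) (M := P ++ M) (E := γ₃ :: γ) (by simp) hq (z' := z)
        (a' := α₁.left) ?_
      simpa using hr
    obtain ⟨M, x, rfl⟩ := Joins.exists_concat hμ.init (by grind)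
    obtain rfl : x = α₂ := by
      obtain ⟨h₃, h₄⟩ := Joins.consecutive (P := M) (T := []) (by simpa using hμ)
      exact g.nonrel_left_unique _ _ _ h₃ h₄ eγ₂ hγ₂
    have hM' := hμ.init.init
    have rM := h.le hM'
    by_cases hm : m₁ = b
    · subst hm
      have h₁ : R.Joins m₁.left (m₁ :: μ₁) m.right := by
        rw [hM, ← el₁]; exact hμ
      obtain ⟨n, μ₂, rfl⟩ := Joins.exists_cons h₁.tail (by grind)
      obtain ⟨h₃, h₄⟩ := Joins.consecutive (P := []) h₁
      obtain rfl := g.nonrel_right_unique _ _ _ h₃ h₄ ebc hbc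
      rcases M with _ | ⟨y, _ | ⟨y', M⟩⟩
      · simp only [List.nil_append, List.cons_append, List.cons.injEq] at hM
        obtain ⟨-, rfl, -⟩ := hM
        rw [ec] at rc
        omega
      · simp only [List.nil_append, List.cons_append, List.cons.injEq] at hM
        exact hcα hM.2.1
      · simp only [List.cons_append, List.cons.injEq] at hM
        obtain ⟨-, rfl, -⟩ := hM
        have := h.le hM'.tail.tail
        grind
    · obtain ⟨rfl, rfl⟩ := hm₁ hm
      rcases M with _ | ⟨y, M⟩
      · simp only [List.nil_append, List.cons_append, List.cons.injEq] at hM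
        obtain ⟨rfl, -⟩ := hM
        rw [e₁₂] at r₁
        omega
      · simp only [List.cons_append, List.cons.injEq] at hM
        obtain ⟨rfl, -⟩ := hM
        obtain ⟨rfl, -⟩ := h.eq_nil hM'.tail (by rw [e₁₂])
        exact (Joins.consecutive (P := []) hμ).2 h₁₂
  · have hl₂ : R.Joins l₁.right (l₂ :: lam) γ₂.right := hlam.tail
    obtain ⟨Λ, l, hΛ⟩ : ∃ Λ l, l₂ :: lam = Λ ++ [l] :=
      exists_eq_concat (by simp)
    obtain ⟨N, n, hN⟩ : ∃ N n, m₁ :: μ₁ = N ++ [n] :=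
      exists_eq_concat (by simp)
    obtain rfl : l = γ₂ := by
      rw [hΛ] at hr
      refine g.last_eq (T := [α₂]) (M := P ++ (m₁ :: μ₁ ++ Λ)) (E := γ₃ :: γ) (by simp) hq
        (z' := z) (a' := α₁.left) ?_
      simpa using hr
    obtain rfl : n = l₁ := by
      rw [hN] at hr
      have hr' : R.Joins α₁.left ((P ++ N) ++ n :: l₂ :: (lam ++ γ₃ :: γ)) z := by simpa using hr
      obtain ⟨h₁, h₂⟩ := hr'.consecutive
      obtain ⟨h₃, h₄⟩ := Joins.consecutive (P := []) hlam
      exact g.nonrel_left_unique _ _ _ h₁ h₂ h₃ h₄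
    have hm : m₁ ≠ b := by
      rintro rfl
      exact h.not_joins_both hb hμ hN
    obtain ⟨rfl, rfl⟩ := hm₁ hm
    have hbα := hbα rfl
    have hΛ' : R.Joins c.left ((n :: Λ) ++ [l]) l.right := by
      rw [hΛ] at hlam
      simpa using hlam
    obtain ⟨Λ', x, hx⟩ : ∃ Λ' x, n :: Λ = Λ' ++ [x] :=
      exists_eq_concat (by simp)
    rw [hx] at hΛ'
    obtain rfl : x = α₂ := by
      obtain ⟨h₃, h₄⟩ := Joins.consecutive (P := Λ') (T := []) (by simpa using hΛ')
      exact g.nonrel_left_unique _ _ _ h₃ h₄ eγ₂ hγ₂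
    have k₁ := h.le hΛ'.init.init
    rcases N with _ | ⟨y, N⟩
    · simp only [List.nil_append, List.cons.injEq] at hN
      grind
    · simp only [List.cons_append, List.cons.injEq] at hN
      have h₂ := hμ.tail
      rw [hN.2] at h₂
      have k₂ := h.le h₂.init
      -- There are paths from the source of c to that of α₂ and back, so the sources agree and c is
      -- parallel to α₂.
      obtain ⟨-, h₅⟩ := h.eq_nil hΛ'.init.init (by grind)
      exact hcα (h.thin _ _ h₅ ec')

/-- The only nonzero term that arises by replacing `c ε₁` by `l₁ lam` and then `b l₁` by `μ`, if
the first path ends with `b c α₂`, comes from a subquiver of the form (◇). -/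
theorem exists_diamond (h : R.IsRanked rk) {α₁ α₂ α₃ b c ε₁ l₁ : Quiver.Total V}
    {P ε lam μ : List (Quiver.Total V)} {z : V} (h₁₂ : R.rel α₁ α₂) (h₂₃ : R.rel α₂ α₃)
    (hp : R.Joins α₁.left (P ++ [b, c, α₂]) α₂.right)
    (hq : R.Joins α₁.right (ε₁ :: ε) α₃.right)
    (hc : R.rel c ε₁) (hlam : R.Joins c.left (l₁ :: lam) ε₁.right) (hb : R.rel b l₁)
    (hμ : R.Joins b.left μ l₁.right)
    (hr : R.Joins α₁.left (P ++ (μ ++ (lam ++ ε))) z) :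
    ∃ D : Diamond R, D.α₁ = α₁ ∧ D.α₂ = α₂ ∧ D.α₃ = α₃ := by
  have g := h.gentle
  have e₁₂ := R.composable h₁₂
  have e₂₃ := R.composable h₂₃
  have ec := R.composable hc
  have eb := R.composable hb
  have r₁ := h.lt α₁
  have r₂ := h.lt α₂
  have r₃ := h.lt α₃
  have rb := h.lt b
  have rc := h.lt c
  have rε₁ := h.lt ε₁
  have rl₁ := h.lt l₁
  obtain ⟨ebc, hbc⟩ := hp.consecutive
  obtain ⟨ecα, hcα⟩ := Joins.consecutive (P := P ++ [b]) (T := []) (by simpa using hp)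
  have hl₁c : l₁ ≠ c := by rintro rfl; exact hbc hb
  have rP := h.le hp.split.1
  have hcα₁ : c ≠ α₁ := by rintro rfl; exact hcα h₁₂
  have hε₁α : ε₁ ≠ α₂ := by rintro rfl; exact hcα hc
  have hαε : ¬ R.rel α₁ ε₁ := fun h' => hε₁α (g.rel_right_unique _ _ _ h' h₁₂)
  obtain ⟨m₁, μ₁, rfl⟩ := Joins.exists_cons hμ (by grind)
  obtain ⟨N, n, hN⟩ : ∃ N n, m₁ :: μ₁ = N ++ [n] :=
    exists_eq_concat (by simp)
  have hbα : α₁ ≠ b := by grind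
  have hm₁ : m₁ ≠ b → P = [] ∧ m₁ = α₁ := by
    intro hm
    have hP : P = [] := by
      by_contra hP
      exact hm (g.first_eq hP hp hr)
    subst hP
    refine ⟨rfl, ?_⟩
    rcases g.eq_or_eq_of_left hbα hp.head_left hr.head_left with h' | h'
    · exact h'
    · exact absurd h' hm
  -- With a second arrow in l₁lam, μ would begin with α₁ and end with l₁. But l₁ starts where c
  -- starts, which has smaller rank than the end of c, and that is the end of α₁.
  obtain rfl : lam = [] := by
    rcases lam with _ | ⟨l₂, lam⟩
    · rfl
    exfalso
    obtain rfl : n = l₁ := by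
      rw [hN] at hr
      have hr' : R.Joins α₁.left ((P ++ N) ++ n :: l₂ :: (lam ++ ε)) z := by simpa using hr
      obtain ⟨h₁, h₂⟩ := hr'.consecutive
      obtain ⟨h₃, h₄⟩ := Joins.consecutive (P := []) hlam
      exact g.nonrel_left_unique _ _ _ h₁ h₂ h₃ h₄
    have hm : m₁ ≠ b := by
      rintro rfl
      exact h.not_joins_both hb hμ hN
    obtain ⟨rfl, rfl⟩ := hm₁ hm
    rcases N with _ | ⟨y, N⟩
    · simp only [List.nil_append, List.cons.injEq] at hN
      grind
    · simp only [List.cons_append, List.cons.injEq] at hN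
      have h₂ := hμ.tail
      rw [hN.2] at h₂
      have k₂ := h.le h₂.init
      grind
  have el₁ : l₁.right = ε₁.right := joins_nil.1 hlam.tail
  have hlε : l₁ ≠ ε₁ := by
    intro h'
    have := hlam.head_left
    grind
  -- If ε₁ were the whole path, α₃, ε₁ and l₁ would be three distinct arrows into one vertex.
  rcases ε with _ | ⟨ε₂, ε⟩
  · have h₁ : ε₁.right = α₃.right := joins_nil.1 hq.tail
    have := hlam.head_left
    rcases g.eq_or_eq_of_right (α := α₃) (β := ε₁) (γ := l₁) (by grind) h₁ (el₁.trans h₁) with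
      rfl | rfl
    · grind
    · grind
  obtain rfl : n = ε₁ := by
    rw [hN] at hr
    refine g.last_eq (T := []) (M := P ++ N) (E := ε₂ :: ε) (by simp) hq (z' := z)
      (a' := α₁.left) ?_
    simpa using hr
  -- Otherwise μ begins with bc and ends with ε₁, which starts where c ends; by acyclicity μ = bcε₁,
  -- but cε₁ = 0.
  have hm : m₁ ≠ b := by
    rintro rfl
    obtain ⟨y, μ₂, rfl⟩ := Joins.exists_cons hμ.tail (by grind)
    obtain ⟨h₃, h₄⟩ := Joins.consecutive (P := []) hμ
    obtain rfl := g.nonrel_right_unique _ _ _ h₃ h₄ ebc hbc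
    rcases N with _ | ⟨x, _ | ⟨x', N⟩⟩
    · simp at hN
    · simp only [List.nil_append, List.cons_append, List.cons.injEq] at hN
      grind
    · simp only [List.cons_append, List.cons.injEq] at hN
      have h₅ := hμ.tail.tail
      rw [hN.2.2] at h₅
      obtain ⟨rfl, -⟩ := h.eq_nil h₅.init (by rw [ec])
      rw [hN.2.2] at hμ
      exact (Joins.consecutive (P := [m₁]) hμ).2 hc
  obtain ⟨rfl, rfl⟩ := hm₁ hm
  have r₆ := h.le hq.tail
  have rl := hlam.head_left
  have hb1 := hp.head_left
  refine ⟨⟨m₁, α₂, α₃, b, c, n, l₁, ε₂ :: ε, h₁₂, h₂₃, hb1, ecα.trans e₁₂.symm, ?_,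
    eb.symm, el₁, by simp, hq.1, hq.2, ?_⟩, rfl, rfl, rfl⟩
  · exact (Joins.split (P := [b, c]) hp).1.1
  -- Ranks order the vertices as 1 < 5 < 2 < 3 < 4 and 2 < 6 < 4. Only 3 ≠ 6 needs more: otherwise
  -- ε₁ and α₂ would be parallel.
  · have h36 : α₂.right ≠ n.right := fun h' => hε₁α (h.thin _ _ (ec.symm.trans ecα) h'.symm)
    simp only [List.nodup_cons, List.mem_cons, List.not_mem_nil, not_or, or_false, not_false_eq_true,
      List.nodup_nil, and_true, List.length_cons] at r₆ ⊢
    refine ⟨⟨?_, ?_, ?_, ?_, ?_⟩, ⟨?_, ?_, ?_, ?_⟩, ⟨?_, ?_, ?_⟩, ⟨?_, ?_⟩, ?_⟩ <;> grind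

end QuadRel.IsRanked
end Configurations

/-! ### Unwinding the recursion for φ_n and v_n. -/

section Brackets

variable {k : Type*} [Field k] {V : Type*} [Quiver V] {R : QuadRel V}

theorem NonzeroPath.joins (p : NonzeroPath R) : R.Joins p.src p.arrows p.tgt := ⟨p.nonzero, rfl⟩

/-- A path and an arrow that compose to a nonzero path are annihilated by `φ_n`. -/
theorem bardzellPhi_arrowClass_eq_zero {n : ℕ} (f : Fin n → BardzellOne k R) {p : NonzeroPath R}
    {γ : Quiver.Total V} {a z : V} {T : List (Quiver.Total V)}
    (h : R.Joins a (p.arrows ++ γ :: T) z) :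
    bardzellPhi n f (Finsupp.single p 1) (arrowClass k R γ) = 0 := by
  by_contra hne
  obtain ⟨p', β, hp, hR⟩ := exists_of_bardzellPhi_arrowClass_ne_zero hne
  rw [hp, List.append_assoc] at h
  exact h.consecutive.2 hR

/-- The support of `L(φ_n(β, γ))` for a linear map `L` and arrows `β` and `γ`. -/
theorem exists_of_map_bardzellPhi_ne_zero {n : ℕ} {g : Fin n → BardzellOne k R}
    {L : QuadAlg k R →ₗ[k] QuadAlg k R} {β γ : Quiver.Total V} {r : NonzeroPath R}
    (h : L (bardzellPhi n g (arrowClass k R β) (arrowClass k R γ)) r ≠ 0) :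
    n = 1 ∧ ∃ u : NonzeroPath R, u.src = β.left ∧ u.tgt = γ.right ∧
      L (Finsupp.single u 1) r ≠ 0 := by
  obtain ⟨u, hu, hr⟩ := exists_of_map_apply_ne_zero h
  obtain rfl := eq_one_of_bardzellPhi_arrowClass_ne_zero (Finsupp.ne_iff.2 ⟨u, hu⟩)
  rw [arrowClass_eq_single, arrowClass_eq_single, bardzellPhi_one] at hu
  obtain ⟨p', β', γ', y, u', hp, hq, -, -, hus, hut, hs, ha⟩ := exists_of_bardzellG_ne_zero hu
  have hp' : p' = [] ∧ β = β' := by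
    have : ([] : List (Quiver.Total V)) ++ [β] = p' ++ [β'] := hp
    obtain ⟨h₁, h₂⟩ := List.append_inj' this rfl
    exact ⟨h₁.symm, by simpa using h₂⟩
  obtain ⟨rfl, rfl⟩ := hp'
  have hq' : [γ] = γ' :: y := hq
  obtain ⟨rfl, rfl⟩ := List.cons.inj hq'
  obtain rfl : u = u' := NonzeroPath.ext' (hs.trans hus.symm) (by simpa using ha)
  exact ⟨rfl, u, hus, hut, hr⟩

/-- The support of a term of `H* v_n` involving a proper initial part of the second path. -/
theorem exists_of_pathMul_bardzellV_ne_zero {n : ℕ} {f : Fin n → BardzellOne k R}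
    {p x r : NonzeroPath R} {γ : Quiver.Total V} {y : List (Quiver.Total V)} {a z : V}
    (hx : R.Joins a (x.arrows ++ γ :: y) z)
    (h : pathMul k R (bardzellV n f (Finsupp.single p 1) (Finsupp.single x 1) (arrowClass k R γ))
      (pathClass k R γ.right y) r ≠ 0) :
    ∃ (m m' : ℕ) (g : Fin m → BardzellOne k R) (g' : Fin m' → BardzellOne k R)
      (s t : NonzeroPath R), 1 ≤ m ∧ 1 ≤ m' ∧ m + m' = n ∧
      bardzellPhi m' g' (Finsupp.single p 1) (Finsupp.single x 1) s ≠ 0 ∧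
      bardzellPhi m g (Finsupp.single s 1) (Finsupp.single (NonzeroPath.ofArrow R γ) 1) t ≠ 0 ∧
      r.src = t.src ∧ r.arrows = t.arrows ++ y := by
  obtain ⟨t, y', ht, hy, -, hs, ha⟩ := exists_of_pathMul_apply_ne_zero h
  obtain ⟨-, hy⟩ := of_pathClass_apply_ne_zero hy
  obtain ⟨m, m', g, g', h₁, h₂, h₃, h₄⟩ := exists_of_bardzellV_ne_zero ht
  -- xγ is part of a nonzero path, so only the term φ(φ(p, x), γ) remains.
  rw [gerstProd_apply, bardzellPhi_arrowClass_eq_zero g' hx, map_zero, sub_zero] at h₄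
  obtain ⟨s, hs', h₄⟩ := exists_of_map_apply_ne_zero (L := (bardzellPhi m g).flip _) h₄
  rw [LinearMap.flip_apply, arrowClass_eq_single] at h₄
  exact ⟨m, m', g, g', s, t, h₁, h₂, h₃, hs', h₄, hs, by rw [ha, hy]⟩

/-- The support of `φ_n`, `n ≥ 2`. -/
theorem exists_of_bardzellPhi_ne_zero {n : ℕ} (hn : n ≠ 1) {f : Fin n → BardzellOne k R}
    {p q r : NonzeroPath R}
    (h : bardzellPhi n f (Finsupp.single p 1) (Finsupp.single q 1) r ≠ 0) :
    (∃ (m : ℕ) (g : Fin m → BardzellOne k R) (p' : NonzeroPath R) (β γ : Quiver.Total V)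
      (y : List (Quiver.Total V)) (u s : NonzeroPath R), 1 ≤ m ∧ m + 1 = n ∧ p'.src = p.src ∧
      p.arrows = p'.arrows ++ [β] ∧ q.arrows = γ :: y ∧ R.rel β γ ∧ u.src = β.left ∧
      u.tgt = γ.right ∧ bardzellPhi m g (Finsupp.single p' 1) (Finsupp.single u 1) s ≠ 0 ∧
      r.src = s.src ∧ r.arrows = s.arrows ++ y) ∨
    (∃ (x : NonzeroPath R) (γ : Quiver.Total V) (y : List (Quiver.Total V)),
      x.src = q.src ∧ x.arrows ≠ [] ∧ q.arrows = x.arrows ++ γ :: y ∧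
      pathMul k R (bardzellV n f (Finsupp.single p 1) (Finsupp.single x 1) (arrowClass k R γ))
        (pathClass k R γ.right y) r ≠ 0) := by
  rw [bardzellPhi_of_ne_one hn] at h
  refine (exists_of_bardzellH_ne_zero h).imp_left ?_
  rintro ⟨p', β, γ, y, s, h₁, h₂, h₃, h₄, h₅, h₆, h₇⟩
  obtain ⟨m, m', g, g', hm, -, hmn, h⟩ := exists_of_bardzellV_ne_zero h₅
  have hp := p.joins
  rw [h₂] at hp
  rw [gerstProd_apply, bardzellPhi_arrowClass_eq_zero g' hp, map_zero, LinearMap.zero_apply,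
    zero_sub, Finsupp.neg_apply, neg_ne_zero] at h
  obtain ⟨rfl, u, hu, hu', h⟩ := exists_of_map_bardzellPhi_ne_zero h
  exact ⟨m, g, p', β, γ, y, u, s, hm, hmn, h₁, h₂, h₃, h₄, hu, hu', h, h₆, h₇⟩

/-- A nonempty B would end with l, placing lγ inside a nonzero path. Thus a replacement at γ can
follow an earlier one only if no old arrow was kept between them. -/
theorem eq_nil_of_rel {A B S pre y : List (Quiver.Total V)} {l γ : Quiver.Total V} {a z : V}
    (h : A ++ B = S ++ [l]) (hq : R.Joins a (pre ++ (B ++ γ :: y)) z) (hl : R.rel l γ) :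
    B = [] := by
  by_contra hB
  obtain ⟨B, b, rfl⟩ := exists_eq_concat hB
  rw [← List.append_assoc] at h
  obtain ⟨-, h₂⟩ := List.append_inj' h rfl
  obtain rfl : b = l := by simpa using h₂
  exact (QuadRel.Joins.consecutive (P := pre ++ B) (by simpa using hq)).2 hl

end Brackets

/-! ### Matching the terms of φ₃ with the four patterns; first half of the theorem. -/

section BracketConfigurations

variable {k : Type*} [Field k] {V : Type*} [Quiver V] {R : QuadRel V} {rk : V → ℕ}

theorem arrows_eq_nil_of_ofArrow {α β : Quiver.Total V} {p : List (Quiver.Total V)}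
    (h : (NonzeroPath.ofArrow R α).arrows = p ++ [β]) : p = [] ∧ β = α := by
  have h' : [] ++ [α] = p ++ [β] := h
  obtain ⟨h₁, h₂⟩ := List.append_inj' h' rfl
  exact ⟨h₁.symm, by simpa using h₂.symm⟩

theorem not_ofArrow_eq_append {α β : Quiver.Total V} {p y : List (Quiver.Total V)} (hp : p ≠ [])
    (h : (NonzeroPath.ofArrow R α).arrows = p ++ β :: y) : False := by
  have := congrArg List.length h
  have hp' := List.length_pos_iff.2 hp
  simp [NonzeroPath.ofArrow] at this
  omega

/-- The terms of `φ₂(p', ε₁⋯ε_p)` coming from proper initial parts of `ε₁⋯ε_p` vanish. -/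
theorem pathMul_bardzellV_two_eq_zero (h : R.IsRanked rk) {α₁ α₂ α₃ : Quiver.Total V}
    (h₁₂ : R.rel α₁ α₂) (h₂₃ : R.rel α₂ α₃) (f : Fin 2 → BardzellOne k R)
    {p q x : NonzeroPath R} {γ : Quiver.Total V} {y : List (Quiver.Total V)}
    (hps : p.src = α₁.left) (hp : R.Joins α₁.left (p.arrows ++ [α₂]) α₂.right)
    (hqs : q.src = α₁.right) (hqt : q.tgt = α₃.right)
    (hq : q.arrows = x.arrows ++ γ :: y) :
    pathMul k R (bardzellV 2 f (Finsupp.single p 1) (Finsupp.single x 1) (arrowClass k R γ))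
      (pathClass k R γ.right y) = 0 := by
  by_contra hne
  obtain ⟨r, hr⟩ := Finsupp.ne_iff.1 hne
  have hqj := q.joins
  rw [hq, hqs, hqt] at hqj
  obtain ⟨m, m', g, g', s, t, hm, hm', hmm, hs, ht, hrs, hra⟩ :=
    exists_of_pathMul_bardzellV_ne_zero hqj hr
  obtain rfl : m = 1 := by omega
  obtain rfl : m' = 1 := by omega
  rw [bardzellPhi_one] at hs ht
  obtain ⟨P, c, ε₁, x', lam, hpP, hxε, hc, -, hl, hl', hss, hsa⟩ := exists_of_bardzellG_ne_zero hs
  obtain ⟨S, l, γ', y', μ, hsS, hγ, hlγ, -, hμ, hμ', hts, hta⟩ := exists_of_bardzellG_ne_zero ht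
  have hγ' : [γ] = γ' :: y' := hγ
  obtain ⟨rfl, rfl⟩ := List.cons.inj hγ'
  rw [hxε] at hqj
  obtain rfl : x' = [] := eq_nil_of_rel (A := P ++ lam.arrows) (pre := [ε₁])
    (by rw [← hsS, hsa, List.append_assoc]) hqj hlγ
  rw [hpP] at hp
  simp only [List.append_nil] at hsa hta
  have hsj := s.joins
  have hrj := r.joins
  have hlj := lam.joins
  have hμj := μ.joins
  rw [hss, hps, hsa] at hsj
  rw [hrs, hts, hss, hps, hra, hta] at hrj
  rw [hl, hl'] at hlj
  rw [hμ, hμ'] at hμj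
  exact h.not_replace_right_right h₁₂ h₂₃ (by simpa using hp) hqj hc hlj hsj (hsa ▸ hsS) hlγ hμj
    (by simpa using hrj)

/-- `φ₃(α₁, q)` vanishes for the paths `q` parallel to `α₂α₃`. -/
theorem bardzellPhi_three_arrow_eq_zero (h : R.IsRanked rk) {α₁ α₂ α₃ : Quiver.Total V}
    (h₁₂ : R.rel α₁ α₂) (h₂₃ : R.rel α₂ α₃) (f : Fin 3 → BardzellOne k R)
    {q : NonzeroPath R} (hqs : q.src = α₂.left) (hqt : q.tgt = α₃.right) :
    bardzellPhi 3 f (arrowClass k R α₁) (Finsupp.single q 1) = 0 := by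
  by_contra hne
  obtain ⟨r, hr⟩ := Finsupp.ne_iff.1 hne
  rw [arrowClass_eq_single] at hr
  have hqj := q.joins
  rw [hqs, hqt, ← R.composable h₁₂] at hqj
  rcases exists_of_bardzellPhi_ne_zero (by norm_num) hr with
    ⟨m, g, p', β, γ, y, u, s, -, -, -, hp, -, -, -, -, hs, -⟩ | ⟨x, γ, y, -, hx, hq, hr'⟩
  · rw [bardzellPhi_single_of_arrows_eq_nil _ (arrows_eq_nil_of_ofArrow hp).1] at hs
    exact hs rfl
  rw [hq] at hqj
  obtain ⟨m, m', g, g', s, t, hm, hm', hmm, hs, ht, hrs, hra⟩ :=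
    exists_of_pathMul_bardzellV_ne_zero hqj hr'
  have hrj := r.joins
  rw [hrs, hra] at hrj
  -- The terms φ₂(φ₁(α₁, x), γ) are excluded by `not_replace_right_left`, the terms φ₁(φ₂(α₁, x), γ)
  -- by `not_replace_right_right'`.
  obtain ⟨rfl, rfl⟩ | ⟨rfl, rfl⟩ : (m' = 1 ∧ m = 2) ∨ (m' = 2 ∧ m = 1) := by omega
  · rw [bardzellPhi_one] at hs
    obtain ⟨P, δ, ε, x', u, hP, hxε, hε, -, hu, hu', hss, hsa⟩ := exists_of_bardzellG_ne_zero hs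
    obtain ⟨rfl, rfl⟩ := arrows_eq_nil_of_ofArrow hP
    obtain rfl := h.gentle.rel_right_unique _ _ _ hε h₁₂
    rw [hxε] at hqj
    rcases exists_of_bardzellPhi_ne_zero (by norm_num) ht with
      ⟨m, g, p', c, γ', y', lam, t', hm, hm', hp's, hsp, hγ, hc, hl, hl', ht', hts, hta⟩ |
      ⟨x, γ', y', -, hx', hγ, -⟩
    · have hγ' : [γ] = γ' :: y' := hγ
      obtain ⟨rfl, rfl⟩ := List.cons.inj hγ'
      obtain rfl : m = 1 := by omega
      obtain rfl : x' = [] := eq_nil_of_rel (A := u.arrows) (pre := [ε]) (by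
        rw [← hsp, hsa]; rfl) hqj hc
      rw [bardzellPhi_one] at ht'
      obtain ⟨P, b, l₁, lam', μ, hp', hll, hb, -, hμ, hμ', ht's, ht'a⟩ :=
        exists_of_bardzellG_ne_zero ht'
      have hu₀ : u.arrows = P ++ [b] ++ [c] := by
        rw [← hp', ← hsp, hsa]; simp
      have huj := u.joins
      have hlj := lam.joins
      have hμj := μ.joins
      rw [hu, hu', hu₀] at huj
      rw [hl, hl', hll] at hlj
      rw [hμ, hμ'] at hμj
      have hsrc : t.src = δ.left := by rw [hts, ht's, hp's, hss]; rfl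
      rw [hsrc, hta, ht'a] at hrj
      exact h.not_replace_right_left h₁₂ h₂₃ (by simpa using huj) hqj hc hlj hb hμj
        (by simpa using hrj)
    · exact not_ofArrow_eq_append hx' hγ
  · rcases exists_of_bardzellPhi_ne_zero (by norm_num) hs with
      ⟨m, g, p', β, γ, y, u, s, -, -, -, hp, -, -, -, -, hs, -⟩ | ⟨x₁, γ₁, y₁, -, hx₁, hxx, hs'⟩
    · rw [bardzellPhi_single_of_arrows_eq_nil _ (arrows_eq_nil_of_ofArrow hp).1] at hs
      exact hs rfl
    have hxj := x.joins
    rw [hxx] at hxj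
    obtain ⟨m, m', g₁, g₁', s₁, t₁, hm, hm', hmm, hs₁, ht₁, hs₁s, hs₁a⟩ :=
      exists_of_pathMul_bardzellV_ne_zero hxj hs'
    obtain rfl : m = 1 := by omega
    obtain rfl : m' = 1 := by omega
    rw [bardzellPhi_one] at hs₁ ht₁ ht
    obtain ⟨P₀, δ, ε, x₁', u, hP, hxε, hε, -, hu, hu', hss, hsa⟩ :=
      exists_of_bardzellG_ne_zero hs₁
    obtain ⟨rfl, rfl⟩ := arrows_eq_nil_of_ofArrow hP
    obtain rfl := h.gentle.rel_right_unique _ _ _ hε h₁₂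
    obtain ⟨P, b, γ₁', y₁', lam, hsP, hγ₁, hb, -, hl, hl', ht₁s, ht₁a⟩ :=
      exists_of_bardzellG_ne_zero ht₁
    have hγ₁' : [γ₁] = γ₁' :: y₁' := hγ₁
    obtain ⟨rfl, rfl⟩ := List.cons.inj hγ₁'
    rw [hxε] at hxj
    obtain rfl : x₁' = [] := eq_nil_of_rel (A := u.arrows) (pre := [ε]) (by
      rw [← hsP, hsa]; rfl) hxj hb
    obtain ⟨S, l, γ', y', μ, hsS, hγ, hlγ, -, hμ, hμ', hts, hta⟩ := exists_of_bardzellG_ne_zero ht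
    have hγ' : [γ] = γ' :: y' := hγ
    obtain ⟨rfl, rfl⟩ := List.cons.inj hγ'
    rw [hxx, hxε] at hqj
    obtain rfl : y₁ = [] := eq_nil_of_rel (A := t₁.arrows) (pre := [ε, γ₁]) (by
      rw [← hsS, hs₁a]) (by simpa using hqj) hlγ
    have hu₀ : u.arrows = P ++ [b] := by
      rw [← hsP, hsa]; simp
    have hsa' : s.arrows = P ++ lam.arrows := by rw [hs₁a, ht₁a]; simp
    have hsrc : s.src = δ.left := by rw [hs₁s, ht₁s, hss]; rfl
    have huj := u.joins
    have hlj := lam.joins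
    have hμj := μ.joins
    have hsj := s.joins
    rw [hu, hu', hu₀] at huj
    rw [hl, hl'] at hlj
    rw [hμ, hμ'] at hμj
    rw [hsrc, hsa'] at hsj
    rw [hts, hsrc, hta] at hrj
    exact h.not_replace_right_right' h₁₂ h₂₃ huj (by simpa using hqj) hb hlj hsj (hsa' ▸ hsS) hlγ
      hμj (by simpa using hrj)

/-- `φ₃(p, α₃)`, for a path `p` parallel to `α₁α₂`, is nonzero only in the presence of a
subquiver of the form (◇). -/
theorem exists_diamond_of_bardzellPhi_three_ne_zero (h : R.IsRanked rk)
    {α₁ α₂ α₃ : Quiver.Total V} (h₁₂ : R.rel α₁ α₂) (h₂₃ : R.rel α₂ α₃)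
    {f : Fin 3 → BardzellOne k R} {p r : NonzeroPath R} (hps : p.src = α₁.left)
    (hpt : p.tgt = α₂.right)
    (hr : bardzellPhi 3 f (Finsupp.single p 1) (arrowClass k R α₃) r ≠ 0) :
    ∃ D : Diamond R, D.α₁ = α₁ ∧ D.α₂ = α₂ ∧ D.α₃ = α₃ := by
  rw [arrowClass_eq_single] at hr
  have hpj := p.joins
  rw [hps, hpt] at hpj
  rcases exists_of_bardzellPhi_ne_zero (by norm_num) hr with
    ⟨m, g, p', β, γ, y, q, s, -, hm, hp's, hp, hγ, hβ, hqs, hqt, hs, hrs, hra⟩ |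
    ⟨x, γ, y, -, hx, hq, -⟩
  swap
  · exact (not_ofArrow_eq_append hx hq).elim
  have hγ' : [α₃] = γ :: y := hγ
  obtain ⟨rfl, rfl⟩ := List.cons.inj hγ'
  -- Only α₂ composes with α₃ to a relation, so p ends with α₂.
  obtain rfl := h.gentle.rel_left_unique _ _ _ hβ h₂₃
  obtain rfl : m = 2 := by omega
  rw [hp] at hpj
  rw [← R.composable h₁₂] at hqs
  rcases exists_of_bardzellPhi_ne_zero (by norm_num) hs with
    ⟨m, g', p'', c, ε₁, ε, u, t, -, hm', hp''s, hp', hq, hc, hu, hu', ht, hst, hsa⟩ |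
    ⟨x, γ, y, -, -, hq, hs'⟩
  swap
  · rw [pathMul_bardzellV_two_eq_zero h h₁₂ h₂₃ g (hp's.trans hps) hpj hqs hqt hq] at hs'
    exact (hs' rfl).elim
  obtain rfl : m = 1 := by omega
  rw [bardzellPhi_one] at ht
  obtain ⟨P, b, l₁, lam, μ, hP, hl, hb, -, hμ, hμ', hts, hta⟩ := exists_of_bardzellG_ne_zero ht
  rw [hp', hP] at hpj
  have hrj := r.joins
  have hqj := q.joins
  have huj := u.joins
  have hμj := μ.joins
  rw [hrs, hst, hts, hp''s, hp's, hps, hra, hsa, hta] at hrj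
  rw [hqs, hqt, hq] at hqj
  rw [hu, hu', hl] at huj
  rw [hμ, hμ'] at hμj
  exact h.exists_diamond h₁₂ h₂₃ (by simpa using hpj) hqj hc huj hb hμj (by simpa using hrj)

/-- If `l₄` does not vanish on `(α₁, α₂, α₃)`, then there is a subquiver of the form (◇) around
`α₁`, `α₂` and `α₃`. -/
theorem exists_diamond_of_bardzellL_ne_zero (h : R.IsRanked rk) {f : Fin 4 → BardzellOne k R}
    {α₁ α₂ α₃ : Quiver.Total V} (hf : bardzellL 4 f α₁ α₂ α₃ ≠ 0) :
    ∃ D : Diamond R, D.α₁ = α₁ ∧ D.α₂ = α₂ ∧ D.α₃ = α₃ := by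
  unfold bardzellL at hf
  split_ifs at hf with hR
  · obtain ⟨h₁₂, h₂₃⟩ := hR
    obtain ⟨r, hr⟩ := Finsupp.ne_iff.1 hf
    obtain ⟨m, m', g, g', -, -, hm, hr⟩ := exists_of_bardzellV_ne_zero hr
    rw [gerstProd_apply, Finsupp.sub_apply] at hr
    by_cases h0 : bardzellPhi m g (bardzellPhi m' g' (arrowClass k R α₁) (arrowClass k R α₂))
        (arrowClass k R α₃) r = 0
    · rw [h0, zero_sub, neg_ne_zero] at hr
      obtain ⟨rfl, u, hu, hu', hr⟩ := exists_of_map_bardzellPhi_ne_zero hr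
      obtain rfl : m = 3 := by omega
      rw [bardzellPhi_three_arrow_eq_zero h h₁₂ h₂₃ g hu hu'] at hr
      exact (hr rfl).elim
    · obtain ⟨rfl, u, hu, hu', hr⟩ := exists_of_map_bardzellPhi_ne_zero
        (L := (bardzellPhi m g).flip (arrowClass k R α₃)) h0
      obtain rfl : m = 3 := by omega
      exact exists_diamond_of_bardzellPhi_three_ne_zero h h₁₂ h₂₃ hu hu' hr
  · exact (hf rfl).elim

end BracketConfigurations

/-! ### Evaluation of v₂, v₃ and l₄ with signs, and the relations in (◇). -/

section DiamondBracket

variable {k : Type*} [Field k] {V : Type*} [Quiver V] {R : QuadRel V} {rk : V → ℕ}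

theorem pathClass_ne_zero {a : V} {l : List (Quiver.Total V)} (h : R.IsNonzeroPath a l) :
    pathClass k R a l ≠ 0 := by
  rw [pathClass, dif_pos h]
  simp

theorem pathMul_pathClass {a b c : V} {l m : List (Quiver.Total V)}
    (h : R.Joins a (l ++ m) c) (hl : pathEnd a l = b) :
    pathMul k R (pathClass k R a l) (pathClass k R b m) = pathClass k R a (l ++ m) := by
  obtain ⟨d, h₁, h₂, -⟩ := QuadRel.joins_append.1 h
  obtain rfl : d = b := h₁.2.symm.trans hl
  rw [pathClass_eq_single ⟨a, l, h₁.1⟩, pathClass_eq_single ⟨d, m, h₂.1⟩]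
  exact pathMul_single _ _ hl

theorem exists_isBasisElement {α β : Quiver.Total V} {u : List (Quiver.Total V)} (h : R.rel α β)
    (hu : R.Joins α.left u β.right) : ∃ f : BardzellOne k R, IsBasisElement f α β u := by
  classical
  refine ⟨⟨fun α' β' => if (α', β') = (α, β) then pathClass k R α.left u else 0,
    fun α' β' => ⟨fun h' => if_neg ?_, fun p hp => ?_⟩⟩, h, hu.1, hu.2, if_pos rfl,
    fun α' β' h' => if_neg h'⟩
  · rintro ⟨⟩
    exact h' h
  · dsimp only at hp
    split_ifs at hp with he
    · obtain ⟨rfl, rfl⟩ := Prod.mk.inj he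
      obtain ⟨h₁, h₂⟩ := of_pathClass_apply_ne_zero hp
      refine ⟨h₁, ?_⟩
      rw [NonzeroPath.tgt, h₁, h₂]
      exact hu.2
    · exact (hp rfl).elim

theorem bardzellG_pathClass {f : BardzellOne k R} {p q : NonzeroPath R} {β γ : Quiver.Total V}
    {p' u y : List (Quiver.Total V)} {z : V} (hp : p.arrows = p' ++ [β]) (hq : q.arrows = γ :: y)
    (hf : f.1 β γ = pathClass k R β.left u) (hu : pathEnd β.left u = γ.right)
    (h : R.Joins p.src (p' ++ u ++ y) z) :
    bardzellG f (Finsupp.single p 1) (Finsupp.single q 1) =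
      pathClass k R p.src (p' ++ u ++ y) := by
  have hpj := p.joins
  rw [hp] at hpj
  obtain ⟨d, h₁, -⟩ := QuadRel.joins_append.1 h
  obtain ⟨e, h₂, h₃, -⟩ := QuadRel.joins_append.1 h₁
  obtain rfl : e = β.left := h₂.2.symm.trans hpj.init.2
  rw [bardzellG, bilinOfPaths_single, hp, hq]
  simp only [List.getLast?_append, List.getLast?_singleton, Option.some_or, List.dropLast_concat]
  rw [hf, pathMul_pathClass h₁ h₂.2, pathMul_pathClass h]
  rw [h₁.2, ← h₃.2, hu]

theorem bardzellG_eq_zero {f : BardzellOne k R} {p q : NonzeroPath R} {β γ : Quiver.Total V}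
    {p' y : List (Quiver.Total V)} (hp : p.arrows = p' ++ [β]) (hq : q.arrows = γ :: y)
    (hf : f.1 β γ = 0) : bardzellG f (Finsupp.single p 1) (Finsupp.single q 1) = 0 := by
  rw [bardzellG, bilinOfPaths_single, hp, hq]
  simp [hf]

/-- Isolates the leading term of H*. The sum over initial parts of q is removed by the hypothesis
`h`, which holds for an arrow q trivially and otherwise by `pathMul_bardzellV_two_eq_zero`. -/
theorem bardzellH_single {v : Cochain3 k R} {p q p' : NonzeroPath R} {β γ : Quiver.Total V}
    {y : List (Quiver.Total V)} (hp' : p'.src = p.src) (hp : p.arrows = p'.arrows ++ [β])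
    (hq : q.arrows = γ :: y) (hR : R.rel β γ)
    (h : ∀ (x : NonzeroPath R) (δ : Quiver.Total V) (z : List (Quiver.Total V)),
      x.src = q.src → x.arrows ≠ [] → q.arrows = x.arrows ++ δ :: z →
      pathMul k R (v (Finsupp.single p 1) (Finsupp.single x 1) (arrowClass k R δ))
        (pathClass k R δ.right z) = 0) :
    bardzellH v (Finsupp.single p 1) (Finsupp.single q 1) =
      pathMul k R (v (Finsupp.single p' 1) (arrowClass k R β) (arrowClass k R γ))
        (pathClass k R γ.right y) := by
  rw [← pathClass_eq_single p', bardzellH, bilinOfPaths_single]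
  split
  · rename_i β' γ' y' hβ hγ
    rw [hp, List.getLast?_concat, Option.some.injEq] at hβ
    rw [hq, List.cons.injEq] at hγ
    obtain rfl := hβ
    obtain ⟨rfl, rfl⟩ := hγ
    rw [Finset.sum_eq_zero, if_pos hR, sub_zero, hp', hp, List.dropLast_concat]
    intro j hj
    split
    · rename_i δ s hδ
      have hj := (Finset.mem_Ico.1 hj).1
      have := h ⟨q.src, q.arrows.take j, q.nonzero.take (by omega)⟩ δ s rfl
        (by simp [hq]; omega) (by rw [← hδ, List.take_append_drop])
      rw [← pathClass_eq_single, ← pathClass_eq_single] at this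
      exact this
    · rfl
  · rename_i hn
    exact (hn β γ y (by simp [hp]) hq).elim

theorem bardzellV_two (g : Fin 2 → BardzellOne k R) :
    bardzellV 2 g = gerstBracket (bardzellG (g 0)) (bardzellG (g 1)) := by
  have h₁ : unshuffles 2 1 = {1} := by decide
  have h₂ : koszulSign (fun _ : Fin 2 => 1) 1 * kappaSign (fun _ : Fin 2 => 1) 1 1 = 1 := by decide
  simp only [bardzellV, bardzellVStep]
  rw [Fin.sum_univ_one]
  change ∑ τ ∈ unshuffles 2 1, _ = _
  rw [h₁, Finset.sum_singleton]
  change (koszulSign (fun _ : Fin 2 => 1) 1 * kappaSign (fun _ : Fin 2 => 1) 1 1) •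
    gerstBracket (bardzellPhi 1 _) (bardzellPhi 1 _) = _
  rw [h₂, one_smul, bardzellPhi_one, bardzellPhi_one]
  rfl

/-- Since pβ is a nonzero path, the terms whose inner map acts on (p, β) vanish. -/
theorem gerstBracket_bardzellPhi_apply {m m' : ℕ} (g : Fin m → BardzellOne k R)
    (g' : Fin m' → BardzellOne k R) {p : NonzeroPath R} {β γ : Quiver.Total V} {a z : V}
    {T : List (Quiver.Total V)} (h : R.Joins a (p.arrows ++ β :: T) z) :
    gerstBracket (bardzellPhi m g) (bardzellPhi m' g') (Finsupp.single p 1) (arrowClass k R β)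
      (arrowClass k R γ) =
    - bardzellPhi m g (Finsupp.single p 1)
        (bardzellPhi m' g' (arrowClass k R β) (arrowClass k R γ)) -
      bardzellPhi m' g' (Finsupp.single p 1)
        (bardzellPhi m g (arrowClass k R β) (arrowClass k R γ)) := by
  rw [gerstBracket_apply, gerstProd_apply, gerstProd_apply,
    bardzellPhi_arrowClass_eq_zero g h, bardzellPhi_arrowClass_eq_zero g' h]
  simp [sub_eq_add_neg]

theorem bardzellPhi_arrowClass_arrowClass {n : ℕ} (hn : n ≠ 1) (g : Fin n → BardzellOne k R)
    (β γ : Quiver.Total V) : bardzellPhi n g (arrowClass k R β) (arrowClass k R γ) = 0 := by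
  by_contra h
  exact hn (eq_one_of_bardzellPhi_arrowClass_ne_zero h)

/-- `v₃(f₁, f₂, f₃)(p, β, γ)`, when only `f₁` is nonzero on `(β, γ)`. -/
theorem bardzellV_three_apply (g : Fin 3 → BardzellOne k R) {p : NonzeroPath R}
    {β γ : Quiver.Total V} {a z : V} {T : List (Quiver.Total V)}
    (h : R.Joins a (p.arrows ++ β :: T) z)
    (h₀ : ∀ i, i ≠ 0 → bardzellG (g i) (arrowClass k R β) (arrowClass k R γ) = 0) :
    bardzellV 3 g (Finsupp.single p 1) (arrowClass k R β) (arrowClass k R γ) =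
      bardzellPhi 2 (fun i => g i.succ) (Finsupp.single p 1)
        (bardzellG (g 0) (arrowClass k R β) (arrowClass k R γ)) := by
  have h₁ : unshuffles 3 1 = {1} := by decide
  -- Here κ = (-1)^((3-1-1)·1) = -1, which cancels the minus sign of the remaining term of the
  -- bracket.
  have h₂ : koszulSign (fun _ : Fin 3 => 1) 1 * kappaSign (fun _ : Fin 3 => 1) 1 1 = -1 := by decide
  -- The condition τ(1) < τ(t+1) keeps the first argument out of the second block, so for t = 2 the
  -- inner φ₁ never receives `g 0`.
  have h₃ : ∀ τ ∈ unshuffles 3 2, τ 2 ≠ 0 := by decide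
  simp only [bardzellV, bardzellVStep, LinearMap.sum_apply, LinearMap.smul_apply]
  rw [Fin.sum_univ_two]
  have e₂ : ∑ τ ∈ unshuffles 3 2,
      (koszulSign (fun _ => 1) τ * kappaSign (fun _ => 1) 2 τ) •
        gerstBracket (bardzellPhi 2 fun i => g (τ ⟨i.val, by omega⟩))
          (bardzellPhi 1 fun i => g (τ ⟨2 + i.val, by omega⟩)) (Finsupp.single p 1)
          (arrowClass k R β) (arrowClass k R γ) = 0 := by
    refine Finset.sum_eq_zero fun τ hτ => ?_
    have hτ' : bardzellG (g (τ ⟨2 + (0 : Fin 1).val, by omega⟩)) (arrowClass k R β)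
        (arrowClass k R γ) = 0 := h₀ _ (h₃ τ hτ)
    rw [gerstBracket_bardzellPhi_apply _ _ h,
      bardzellPhi_arrowClass_arrowClass (show 2 ≠ 1 by norm_num), bardzellPhi_one, hτ']
    simp
  have e₁ : ∑ τ ∈ unshuffles 3 1,
      (koszulSign (fun _ => 1) τ * kappaSign (fun _ => 1) 1 τ) •
        gerstBracket (bardzellPhi 1 fun i => g (τ ⟨i.val, by omega⟩))
          (bardzellPhi 2 fun i => g (τ ⟨1 + i.val, by omega⟩)) (Finsupp.single p 1)
          (arrowClass k R β) (arrowClass k R γ) = bardzellPhi 2 (fun i => g i.succ)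
        (Finsupp.single p 1) (bardzellG (g 0) (arrowClass k R β) (arrowClass k R γ)) := by
    rw [h₁, Finset.sum_singleton, h₂, gerstBracket_bardzellPhi_apply _ _ h,
      bardzellPhi_arrowClass_arrowClass (by norm_num), bardzellPhi_one]
    have : (fun i : Fin 2 => g ((1 : Equiv.Perm (Fin 3)) ⟨1 + i.val, by omega⟩)) =
        fun i => g i.succ := by
      funext i
      congr 1
      ext
      simp [add_comm]
    rw [this]
    simp
  refine (congrArg₂ (· + ·) e₁ e₂).trans (add_zero _)

/-- `l₄(f₁, f₂, f₃, f₄)(α₁, α₂, α₃)`, when only `f₁` is nonzero on `(α₁, α₂)`. -/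
theorem bardzellL_four_apply (h : R.IsRanked rk) (f : Fin 4 → BardzellOne k R)
    {α₁ α₂ α₃ : Quiver.Total V} (h₁₂ : R.rel α₁ α₂) (h₂₃ : R.rel α₂ α₃)
    (h₀ : ∀ i, i ≠ 0 → bardzellG (f i) (arrowClass k R α₁) (arrowClass k R α₂) = 0) :
    bardzellL 4 f α₁ α₂ α₃ = bardzellPhi 3 (fun i => f i.succ)
      (bardzellG (f 0) (arrowClass k R α₁) (arrowClass k R α₂)) (arrowClass k R α₃) := by
  have h₁ : unshuffles 4 1 = {1} := by decide
  have h₂ : koszulSign (fun _ : Fin 4 => 1) 1 * kappaSign (fun _ : Fin 4 => 1) 1 1 = 1 := by decide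
  have h₃ : ∀ τ ∈ unshuffles 4 3, τ 3 ≠ 0 := by decide
  have hB : ∀ (g : Fin 3 → BardzellOne k R) (g' : Fin 1 → BardzellOne k R),
      bardzellPhi 3 g (arrowClass k R α₁)
        (bardzellPhi 1 g' (arrowClass k R α₂) (arrowClass k R α₃)) = 0 := by
    intro g g'
    by_contra hne
    obtain ⟨r, hr⟩ := Finsupp.ne_iff.1 hne
    obtain ⟨-, u, hu, hu', hr⟩ := exists_of_map_bardzellPhi_ne_zero hr
    rw [bardzellPhi_three_arrow_eq_zero h h₁₂ h₂₃ g hu hu'] at hr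
    exact hr rfl
  rw [bardzellL, if_pos ⟨h₁₂, h₂₃⟩]
  simp only [bardzellV, bardzellVStep, LinearMap.sum_apply, LinearMap.smul_apply]
  rw [Fin.sum_univ_three]
  have e₁ : ∑ τ ∈ unshuffles 4 1,
      (koszulSign (fun _ => 1) τ * kappaSign (fun _ => 1) 1 τ) •
        gerstBracket (bardzellPhi 1 fun i => f (τ ⟨i.val, by omega⟩))
          (bardzellPhi 3 fun i => f (τ ⟨1 + i.val, by omega⟩)) (arrowClass k R α₁)
          (arrowClass k R α₂) (arrowClass k R α₃) = bardzellPhi 3 (fun i => f i.succ)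
      (bardzellG (f 0) (arrowClass k R α₁) (arrowClass k R α₂)) (arrowClass k R α₃) := by
    rw [h₁, Finset.sum_singleton, h₂, gerstBracket_apply, gerstProd_apply, gerstProd_apply, hB,
      bardzellPhi_arrowClass_arrowClass (by norm_num),
      bardzellPhi_arrowClass_arrowClass (by norm_num), bardzellPhi_one]
    have : (fun i : Fin 3 => f ((1 : Equiv.Perm (Fin 4)) ⟨1 + i.val, by omega⟩)) =
        fun i => f i.succ := by
      funext i
      congr 1
      ext
      simp [add_comm]
    rw [this]
    simp
  have e₂ : ∑ τ ∈ unshuffles 4 2,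
      (koszulSign (fun _ => 1) τ * kappaSign (fun _ => 1) 2 τ) •
        gerstBracket (bardzellPhi 2 fun i => f (τ ⟨i.val, by omega⟩))
          (bardzellPhi 2 fun i => f (τ ⟨2 + i.val, by omega⟩)) (arrowClass k R α₁)
          (arrowClass k R α₂) (arrowClass k R α₃) = 0 := by
    refine Finset.sum_eq_zero fun τ hτ => ?_
    rw [gerstBracket_apply, gerstProd_apply, gerstProd_apply]
    simp only [bardzellPhi_arrowClass_arrowClass (show 2 ≠ 1 by norm_num)]
    simp
  have e₃ : ∑ τ ∈ unshuffles 4 3,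
      (koszulSign (fun _ => 1) τ * kappaSign (fun _ => 1) 3 τ) •
        gerstBracket (bardzellPhi 3 fun i => f (τ ⟨i.val, by omega⟩))
          (bardzellPhi 1 fun i => f (τ ⟨3 + i.val, by omega⟩)) (arrowClass k R α₁)
          (arrowClass k R α₂) (arrowClass k R α₃) = 0 := by
    refine Finset.sum_eq_zero fun τ hτ => ?_
    have hτ' : bardzellG (f (τ ⟨3 + (0 : Fin 1).val, by omega⟩)) (arrowClass k R α₁)
        (arrowClass k R α₂) = 0 := h₀ _ (h₃ τ hτ)
    rw [gerstBracket_apply, gerstProd_apply, gerstProd_apply, hB]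
    simp only [bardzellPhi_arrowClass_arrowClass (show 3 ≠ 1 by norm_num)]
    rw [bardzellPhi_one, hτ']
    simp
  refine (congrArg₂ (· + ·) (congrArg₂ (· + ·) e₁ e₂) e₃).trans ?_
  simp

theorem QuadRel.IsNonzeroPath.joins {a b : V} {l : List (Quiver.Total V)}
    (h : R.IsNonzeroPath a l) (hb : pathEnd a l = b) : R.Joins a l b := ⟨h, hb⟩

/-- The arrows of a subquiver of the form (◇) that compose to zero or not, by gentleness. -/
theorem Diamond.relations (h : R.IsRanked rk) (D : Diamond R) :
    R.rel D.β₂ D.ε₁ ∧ R.rel D.β₁ D.lam ∧ ¬ R.rel D.β₂ D.α₂ ∧ ¬ R.rel D.α₁ D.ε₁ := by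
  have g := h.gentle
  have hβ := D.β_nonzero.joins rfl
  obtain ⟨e, hββ⟩ := QuadRel.Joins.consecutive (P := []) hβ
  have hε := (D.eps_nonzero.joins rfl).head_left
  have hd := D.vertices_distinct
  have e₁ := R.composable D.rel₁₂
  have e₂ := D.β₁_left
  have e₃ := D.β₂_right
  have e₄ := D.lam_left
  have e₅ := D.lam_right
  simp only [List.nodup_cons, List.mem_cons, List.not_mem_nil, or_false, not_or] at hd
  have n₁ : D.β₂ ≠ D.α₁ := by grind
  have n₂ : D.ε₁ ≠ D.α₂ := by grind
  have n₃ : D.lam ≠ D.β₂ := by grind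
  -- The relation starting with α₁ is already used by α₂. So α₁ is the unique nonzero predecessor of
  -- ε₁, forcing β₂ε₁ ∈ I; likewise β₁β₂ ≠ 0 forces β₁λ ∈ I.
  have h₁ : ¬ R.rel D.α₁ D.ε₁ := fun h' => n₂ (g.rel_right_unique _ _ _ h' D.rel₁₂)
  refine ⟨?_, ?_, fun h' => n₁ (g.rel_left_unique _ _ _ h' D.rel₁₂), h₁⟩
  · by_contra h'
    exact n₁ (g.nonrel_left_unique D.ε₁ _ _ (e₃.trans hε.symm) h' hε.symm h₁)
  · by_contra h'
    exact n₃ (g.nonrel_right_unique D.β₁ _ _ e₄.symm h' e hββ)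

end DiamondBracket

/-! ### The value of l₄ on the basis elements attached to (◇). -/

section DiamondValue

variable {k : Type*} [Field k] {V : Type*} [Quiver V] {R : QuadRel V} {rk : V → ℕ}

theorem bardzellG_arrowClass {f : BardzellOne k R} {α β : Quiver.Total V}
    {u : List (Quiver.Total V)} (h : IsBasisElement f α β u) :
    bardzellG f (arrowClass k R α) (arrowClass k R β) = pathClass k R α.left u := by
  rw [arrowClass_eq_single, arrowClass_eq_single]
  refine (bardzellG_pathClass (p' := []) (y := []) (z := β.right) rfl rfl h.2.2.2.1 h.2.2.1
    (by rw [List.nil_append, List.append_nil]; exact h.2.1.joins h.2.2.1)).trans ?_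
  rw [List.nil_append, List.append_nil]
  rfl

theorem bardzellG_arrowClass_eq_zero {f : BardzellOne k R} {α β α' β' : Quiver.Total V}
    {u : List (Quiver.Total V)} (h : IsBasisElement f α β u) (hne : (α', β') ≠ (α, β)) :
    bardzellG f (arrowClass k R α') (arrowClass k R β') = 0 := by
  rw [arrowClass_eq_single, arrowClass_eq_single]
  exact bardzellG_eq_zero (p' := []) rfl rfl (h.2.2.2.2 _ _ hne)

/-- The value of `l₄` on the basis elements given by a subquiver of the form (◇). -/
theorem Diamond.bardzellL_eq (h : R.IsRanked rk) (D : Diamond R) {f : Fin 4 → BardzellOne k R}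
    (h₀ : IsBasisElement (f 0) D.α₁ D.α₂ [D.β₁, D.β₂, D.α₂])
    (h₁ : IsBasisElement (f 1) D.α₂ D.α₃ (D.ε₁ :: D.eps))
    (h₂ : IsBasisElement (f 2) D.β₂ D.ε₁ [D.lam])
    (h₃ : IsBasisElement (f 3) D.β₁ D.lam [D.α₁, D.ε₁])
    (hαε : R.Joins D.α₁.left (D.α₁ :: D.ε₁ :: D.eps) D.α₃.right) :
    bardzellL 4 f D.α₁ D.α₂ D.α₃ = - pathClass k R D.α₁.left (D.α₁ :: D.ε₁ :: D.eps) := by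
  have e₁ := R.composable D.rel₁₂
  have hβj := D.β_nonzero.joins rfl
  obtain ⟨e₂, -⟩ := QuadRel.Joins.consecutive (P := []) hβj
  have e₃ := D.β₁_left
  have hd := D.vertices_distinct
  simp only [List.nodup_cons, List.mem_cons, List.not_mem_nil, or_false, not_or] at hd
  have n₁ : D.α₁ ≠ D.α₂ := by grind
  have n₂ : D.α₁ ≠ D.β₂ := by grind
  have n₃ : D.α₁ ≠ D.β₁ := by grind
  have n₄ : D.α₂ ≠ D.β₂ := by grind
  have n₅ : D.α₂ ≠ D.β₁ := by grind
  have n₆ : D.β₂ ≠ D.β₁ := by grind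
  let p : NonzeroPath R := ⟨D.α₁.left, [D.β₁, D.β₂, D.α₂], h₀.2.1⟩
  let p' : NonzeroPath R := ⟨D.α₁.left, [D.β₁, D.β₂], D.β_nonzero⟩
  let q : NonzeroPath R := ⟨D.α₂.left, D.ε₁ :: D.eps, h₁.2.1⟩
  have hp : R.Joins D.α₁.left (p'.arrows ++ [D.α₂]) D.α₂.right := h₀.2.1.joins h₀.2.2.1
  have hφ₂ : bardzellPhi 2 (fun i => f i.succ.succ) (Finsupp.single p' 1) (Finsupp.single q 1) =
      - pathClass k R D.α₁.left (D.α₁ :: D.ε₁ :: D.eps) := by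
    rw [bardzellPhi_of_ne_one (by norm_num),
      bardzellH_single (p := p') (q := q) (p' := NonzeroPath.ofArrow R D.β₁) (β := D.β₂) (γ := D.ε₁)
        (y := D.eps) D.β₁_left rfl rfl h₂.1 fun x δ z _ _ hq =>
          pathMul_bardzellV_two_eq_zero (p := p') (q := q) h D.rel₁₂ D.rel₂₃ _ rfl hp e₁.symm
            h₁.2.2.1 hq,
      bardzellV_two, ← arrowClass_eq_single, gerstBracket_apply, gerstProd_apply, gerstProd_apply]
    change pathMul k R (bardzellG (f 2) (bardzellG (f 3) _ _) _ -
      bardzellG (f 2) _ (bardzellG (f 3) _ _) + (bardzellG (f 3) (bardzellG (f 2) _ _) _ -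
      bardzellG (f 3) _ (bardzellG (f 2) _ _))) _ = _
    -- Of the four terms only the last survives: `f 2` sends (β₂, ε₁) to λ, then `f 3` sends (β₁, λ)
    -- to α₁ε₁. Its minus sign is that of the final value.
    have e : bardzellG (f 2) (arrowClass k R D.β₂) (arrowClass k R D.ε₁) =
        arrowClass k R D.lam := by
      rw [bardzellG_arrowClass h₂, e₂.symm.trans D.lam_left.symm]
      rfl
    rw [e, bardzellG_arrowClass h₃, bardzellG_arrowClass_eq_zero h₃ (α' := D.β₂) (β' := D.ε₁)
        (by simp [n₆]),
      bardzellG_arrowClass_eq_zero h₂ (α' := D.β₁) (β' := D.β₂)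
        (by simp [n₆.symm]),
      bardzellG_arrowClass_eq_zero h₃ (α' := D.β₁) (β' := D.β₂) (by
        have := D.lam_right
        have := D.β₂_right
        grind)]
    simp only [map_zero, LinearMap.zero_apply, sub_zero, zero_add, zero_sub, map_neg,
      LinearMap.neg_apply]
    rw [D.β₁_left]
    exact congrArg Neg.neg (pathMul_pathClass (l := [D.α₁, D.ε₁]) hαε rfl)
  have hL := bardzellL_four_apply h f D.rel₁₂ D.rel₂₃ (by
    intro i hi
    fin_cases i
    · exact absurd rfl hi
    · exact bardzellG_arrowClass_eq_zero h₁ (by simp [n₁])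
    · exact bardzellG_arrowClass_eq_zero h₂ (by simp [n₂])
    · exact bardzellG_arrowClass_eq_zero h₃ (by simp [n₃]))
  rw [hL, bardzellG_arrowClass h₀, pathClass_eq_single p, arrowClass_eq_single D.α₃,
    bardzellPhi_of_ne_one (by norm_num),
    bardzellH_single (p := p) (q := NonzeroPath.ofArrow R D.α₃) (p' := p') (β := D.α₂)
      (γ := D.α₃) (y := []) rfl rfl rfl D.rel₂₃ fun x δ z _ hx hq => (not_ofArrow_eq_append hx hq).elim,
    bardzellV_three_apply _ hp]
  · change pathMul k R (bardzellPhi 2 _ _ (bardzellG (f 1) _ _)) _ = _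
    rw [bardzellG_arrowClass h₁, pathClass_eq_single q]
    refine (congrArg (fun x => pathMul k R x (pathClass k R D.α₃.right [])) hφ₂).trans ?_
    rw [map_neg, LinearMap.neg_apply,
      pathMul_pathClass (c := D.α₃.right) (by simpa using hαε) hαε.2, List.append_nil]
  · intro i hi
    fin_cases i
    · exact absurd rfl hi
    · exact bardzellG_arrowClass_eq_zero h₂ (by simp [n₄])
    · exact bardzellG_arrowClass_eq_zero h₃ (by simp [n₅])

end DiamondValue

/-! ### The theorem. -/

theorem mainTheorem2 {k : Type*} [Field k] [CharZero k] {V : Type*} [Quiver V] (R : QuadRel V)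
    (gentle : R.IsGentle)
    (no_oriented_cycles : ∀ (a : V) (p : Quiver.Path a a), p.length = 0)
    (no_parallel_arrows : Quiver.IsThin V) :
    (∀ f : Fin 4 → BardzellOne k R, bardzellL 4 f ≠ 0 →
      ∃ D : Diamond R, bardzellL 4 f D.α₁ D.α₂ D.α₃ ≠ 0) ∧
    (∀ D : Diamond R, ∃ f : Fin 4 → BardzellOne k R,
      IsBasisElement (f 0) D.α₁ D.α₂ [D.β₁, D.β₂, D.α₂] ∧
      IsBasisElement (f 1) D.α₂ D.α₃ (D.ε₁ :: D.eps) ∧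
      IsBasisElement (f 2) D.β₂ D.ε₁ [D.lam] ∧
      IsBasisElement (f 3) D.β₁ D.lam [D.α₁, D.ε₁] ∧
      bardzellL 4 f D.α₁ D.α₂ D.α₃ = - pathClass k R D.α₁.left (D.α₁ :: D.ε₁ :: D.eps) ∧
      pathClass k R D.α₁.left (D.α₁ :: D.ε₁ :: D.eps) ≠ 0) := by
  obtain ⟨rk, h⟩ := QuadRel.exists_isRanked gentle no_oriented_cycles no_parallel_arrows
  refine ⟨fun f hf => ?_, fun D => ?_⟩
  · obtain ⟨α₁, h₁⟩ := Function.ne_iff.1 hf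
    obtain ⟨α₂, h₂⟩ := Function.ne_iff.1 h₁
    obtain ⟨α₃, h₃⟩ := Function.ne_iff.1 h₂
    obtain ⟨D, rfl, rfl, rfl⟩ := exists_diamond_of_bardzellL_ne_zero h h₃
    exact ⟨D, h₃⟩
  · obtain ⟨r₁, r₂, hβα, hαε⟩ := D.relations h
    have e₁ := R.composable D.rel₁₂
    have hε := D.eps_nonzero.joins D.eps_end
    have hββ := QuadRel.Joins.consecutive (P := []) (D.β_nonzero.joins rfl)
    have hpath : R.Joins D.α₁.left (D.α₁ :: D.ε₁ :: D.eps) D.α₃.right :=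
      QuadRel.joins_cons.2 ⟨rfl, hε, by simpa using hαε⟩
    obtain ⟨f₀, h₀⟩ := exists_isBasisElement (k := k) (u := [D.β₁, D.β₂, D.α₂]) D.rel₁₂ (by
      simp only [QuadRel.joins_cons, QuadRel.joins_nil]
      simp [D.β₁_left, hββ, D.β₂_right, hβα, e₁])
    obtain ⟨f₁, h₁⟩ := exists_isBasisElement (k := k) (u := D.ε₁ :: D.eps) D.rel₂₃ (e₁ ▸ hε)
    obtain ⟨f₂, h₂⟩ := exists_isBasisElement (k := k) (u := [D.lam]) r₁ (by
      simp only [QuadRel.joins_cons, QuadRel.joins_nil]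
      simp [D.lam_left, D.lam_right, hββ.1])
    obtain ⟨f₃, h₃⟩ := exists_isBasisElement (k := k) (u := [D.α₁, D.ε₁]) r₂ (by
      simp only [QuadRel.joins_cons, QuadRel.joins_nil]
      simp [D.β₁_left, D.lam_right, hαε, hε.head_left])
    exact ⟨![f₀, f₁, f₂, f₃], h₀, h₁, h₂, h₃, D.bardzellL_eq h h₀ h₁ h₂ h₃ hpath,
      pathClass_ne_zero hpath.1⟩
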